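/- **Setting.** Consider the control-affine system $$\dot x=f(x)+\sum_{i=1}^m g_i(x)u_i,\qquad y=h(x),$$ whose state space $\mathcal X\subset\mathbb R^n$ is an open subset or a smooth embedded submanifold of $\mathbb R^n$, with set of input values $\mathcal U\subset\mathbb R^m$, where $f,g_1,\dots,g_m$ are smooth vector fields on $\mathcal X$ and $h:\mathcal X\to\mathbb R^m$ is smooth. Suppose the system is passive with a $C^1$ storage function $V:\mathcal X\to[0,\infty)$: for every piecewise continuous $u:[0,\infty)\to\mathcal U$ and every solution $x(\cdot)$ of the system on $[0,T]$ under $u$, $$V(x(T))-V(x(0))\le\int_0^T u(t)^\top h(x(t))\,dt .$$ Let $u=-\varphi(x)$ be a passivity-based feedback: $\varphi:\mathcal X\to\mathbb R^m$ is smooth, $-\varphi(x)\in\mathcal U$ for all $x$, $\varphi(x)=0$ whenever $h(x)=0$, and $h(x)^\top\varphi(x)>0$ whenever $h(x)\ne0$. The open-loop system is $\dot x=f(x)$; the closed-loop system is $\dot x=f(x)-\sum_i g_i(x)\varphi_i(x)$. Let $\Gamma\subset\mathcal X$ be nonempty, closed in $\mathcal X$, positively invariant for the open-loop system, and contained in $V^{-1}(0)$.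 **Notions.** Consider $\dot x=F(x)$ on $\mathcal X$ with solutions $\phi(t,x_0)$; writing $\phi([0,\infty),\cdot)$, or a limit as $t\to\infty$, includes the assertion that the solutions exist for all $t\ge0$. Let $\|x\|_\Gamma=\inf_{z\in\Gamma}\|x-z\|$, $B_\varepsilon(\Gamma)=\{x\in\mathcal X:\|x\|_\Gamma<\varepsilon\}$ and $B_r(x)=\{z\in\mathcal X:\|z-x\|<r\}$. For $O\subset\mathcal X$, $\Gamma$ is * *stable relative to $O$* if for every $\varepsilon>0$ there is an open neighbourhood $N$ of $\Gamma$ in $\mathcal X$ with $\phi([0,\infty),N\cap O)\subset B_\varepsilon(\Gamma)$; * a *semi-attractor relative to $O$* if there is an open neighbourhood $N$ of $\Gamma$ in $\mathcal X$ with $\|\phi(t,x_0)\|_\Gamma\to0$ as $t\to\infty$ for all $x_0\in N\cap O$, and a *global attractor relative to $O$* if this holds for all $x_0\in O$; * *[globally] semi-asymptotically stable relative to $O$* if it is stable and a semi-attractor [global attractor] relative to $O$; for $O=\mathcal X$ the words "relative to $O$" are omitted; * for compact $\Gamma$, *asymptotically stable* if for every $\varepsilon>0$ there is $\delta>0$ with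 $\phi([0,\infty),B_\delta(\Gamma))\subset B_\varepsilon(\Gamma)$, and there is $\delta>0$ such that $\|\phi(t,x_0)\|_\Gamma\to0$ for all $x_0\in B_\delta(\Gamma)$; *globally asymptotically stable* if the first property holds and $\|\phi(t,x_0)\|_\Gamma\to0$ for all $x_0\in\mathcal X$. *All trajectories are bounded* if for every $x_0\in\mathcal X$ the set $\phi([0,\infty),x_0)$ is bounded and its closure in $\mathbb R^n$ is contained in $\mathcal X$. The system is *locally uniformly bounded near $\Gamma$* if for every $x\in\Gamma$ there are $\lambda,r>0$ such that $\phi([0,\infty),B_\lambda(x))\subset B_r(x)$ and the closure in $\mathbb R^n$ of $\phi([0,\infty),B_\lambda(x))$ is contained in $\mathcal X$. (The closure conditions hold automatically if $\mathcal X$ is closed in $\mathbb R^n$, in particular if $\mathcal X=\mathbb R^n$.) Let $\mathcal O$ be the maximal subset of $h^{-1}(0)$ that is invariant for the open-loop system, i.e. open-loop solutions starting in it stay in it on their whole maximal interval of existence, forward and backward in time. The system is *locally $\Gamma$-detectable* [*$\Gamma$-detectable*] if $\Gamma$ is semi-asymptotically stable [globally semi-asymptotically stable] relative to $\mathcal O$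 for the open-loop system. **Theorem.** 1. Suppose $\Gamma$ is compact. Then $\Gamma$ is asymptotically stable for the closed-loop system if and only if the system is locally $\Gamma$-detectable. If moreover all trajectories of the closed-loop system are bounded, then $\Gamma$ is globally asymptotically stable for the closed-loop system if and only if the system is $\Gamma$-detectable. 2. Suppose $\Gamma$ is not compact (for instance, unbounded) and the closed-loop system is locally uniformly bounded near $\Gamma$. Then $\Gamma$ is semi-asymptotically stable for the closed-loop system if and only if the system is locally $\Gamma$-detectable. If moreover all trajectories of the closed-loop system are bounded, then $\Gamma$ is globally semi-asymptotically stable for the closed-loop system if and only if the system is $\Gamma$-detectable. -/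

import Mathlib

open Set Filter Topology
open scoped ContDiff

/-- Euclidean space `ℝⁿ` with the Euclidean norm. -/
abbrev Vec (n : ℕ) : Type := EuclideanSpace ℝ (Fin n)

/-- `X` is a smooth (embedded) submanifold of `ℝⁿ`: for some `d`, around each of its points there is
a smooth chart of `ℝⁿ` which straightens `X` to `{y | y i = 0 for all i ≥ d}`.
With `d = n` these are exactly the open subsets of `ℝⁿ`. -/
def IsSmoothSubmanifold {n : ℕ} (X : Set (Vec n)) : Prop :=
  ∃ d : ℕ, ∀ x ∈ X, ∃ e : OpenPartialHomeomorph (Vec n) (Vec n), x ∈ e.source ∧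
    ContDiffOn ℝ ∞ e e.source ∧ ContDiffOn ℝ ∞ e.symm e.target ∧
    ∀ z ∈ e.source, z ∈ X ↔ ∀ i : Fin n, d ≤ (i : ℕ) → e z i = 0

/-- `v` is tangent to `X` at `x`: it is the velocity at `x` of a curve lying in `X`. -/
def IsTangentVector {n : ℕ} (X : Set (Vec n)) (x v : Vec n) : Prop :=
  ∃ c : ℝ → Vec n, c 0 = x ∧ (∀ᶠ t in 𝓝 (0 : ℝ), c t ∈ X) ∧ HasDerivAt c v 0

/-- `F` restricts to a smooth vector field on the submanifold `X`. -/
def IsSmoothVectorField {n : ℕ} (X : Set (Vec n)) (F : Vec n → Vec n) : Prop :=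
  ContDiffOn ℝ ∞ F X ∧ ∀ x ∈ X, IsTangentVector X x (F x)

/-! ### Dynamical systems `ẋ = F x` on `X` -/

section Dynamics

variable {n : ℕ} (F : Vec n → Vec n) (X : Set (Vec n))

/-- `c` is a solution of `ẋ = F x` in the state space `X` on the time interval `J`. -/
def IsSolutionOn (c : ℝ → Vec n) (J : Set ℝ) : Prop :=
  MapsTo c J X ∧ IsIntegralCurveOn c (fun _ => F) J

/-- `c` restricted to `[0, ∞)` is the solution `t ↦ φ(t, x₀)` of `ẋ = F x` in `X` starting at `x₀`;
in particular this solution exists for all `t ≥ 0`. -/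
def IsTrajectory (x₀ : Vec n) (c : ℝ → Vec n) : Prop :=
  c 0 = x₀ ∧ IsSolutionOn F X c (Ici 0)

/-- `S` is invariant: solutions starting in `S` stay in `S`, forward and backward in time, as long
as they exist. -/
def IsInvariantSet (S : Set (Vec n)) : Prop :=
  ∀ (J : Set ℝ) (c : ℝ → Vec n), J.OrdConnected → 0 ∈ J → IsSolutionOn F X c J → c 0 ∈ S →
    ∀ t ∈ J, c t ∈ S

/-- `S` is positively invariant: solutions starting in `S` stay in `S` in forward time, as long as
they exist. -/
def IsPositivelyInvariantSet (S : Set (Vec n)) : Prop :=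
  ∀ (J : Set ℝ) (c : ℝ → Vec n), J.OrdConnected → 0 ∈ J → IsSolutionOn F X c J → c 0 ∈ S →
    ∀ t ∈ J, 0 ≤ t → c t ∈ S

/-- `G` is stable relative to `O`: for all `ε > 0` there is a neighbourhood `N` of `G` such that
`φ([0, ∞), N ∩ O) ⊆ B_ε(G)`. -/
def StableRel (O G : Set (Vec n)) : Prop :=
  ∀ ε : ℝ, 0 < ε → ∃ N : Set (Vec n), IsOpen N ∧ G ⊆ N ∧
    ∀ x₀ ∈ X ∩ N ∩ O, ∃ c, IsTrajectory F X x₀ c ∧ ∀ t : ℝ, 0 ≤ t → Metric.infDist (c t) G < ε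

/-- The solution starting at `x₀` exists for all `t ≥ 0` and `‖φ(t, x₀)‖_G → 0` as `t → ∞`. -/
def ConvergesTo (G : Set (Vec n)) (x₀ : Vec n) : Prop :=
  ∃ c, IsTrajectory F X x₀ c ∧ Tendsto (fun t => Metric.infDist (c t) G) atTop (𝓝 0)

/-- `G` is a semi-attractor relative to `O`. -/
def SemiAttractorRel (O G : Set (Vec n)) : Prop :=
  ∃ N : Set (Vec n), IsOpen N ∧ G ⊆ N ∧ ∀ x₀ ∈ X ∩ N ∩ O, ConvergesTo F X G x₀

/-- `G` is a global attractor relative to `O`. -/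
def GlobalAttractorRel (O G : Set (Vec n)) : Prop :=
  ∀ x₀ ∈ X ∩ O, ConvergesTo F X G x₀

/-- `G` is semi-asymptotically stable relative to `O`. -/
def SemiAsymptoticallyStableRel (O G : Set (Vec n)) : Prop :=
  StableRel F X O G ∧ SemiAttractorRel F X O G

/-- `G` is globally semi-asymptotically stable relative to `O`. -/
def GloballySemiAsymptoticallyStableRel (O G : Set (Vec n)) : Prop :=
  StableRel F X O G ∧ GlobalAttractorRel F X O G

/-- `G` is semi-asymptotically stable (initial conditions are not restricted). -/
def SemiAsymptoticallyStable (G : Set (Vec n)) : Prop :=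
  SemiAsymptoticallyStableRel F X univ G

/-- `G` is globally semi-asymptotically stable. -/
def GloballySemiAsymptoticallyStable (G : Set (Vec n)) : Prop :=
  GloballySemiAsymptoticallyStableRel F X univ G

/-- Uniform stability in the `ε`-`δ` sense, with the tubes `B_δ(G)` as neighbourhoods. -/
def UniformlyStable (G : Set (Vec n)) : Prop :=
  ∀ ε : ℝ, 0 < ε → ∃ δ : ℝ, 0 < δ ∧ ∀ x₀ ∈ X, Metric.infDist x₀ G < δ →
    ∃ c, IsTrajectory F X x₀ c ∧ ∀ t : ℝ, 0 ≤ t → Metric.infDist (c t) G < ε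

/-- `G` is asymptotically stable in the `ε`-`δ` sense. -/
def AsymptoticallyStable (G : Set (Vec n)) : Prop :=
  UniformlyStable F X G ∧
    ∃ δ : ℝ, 0 < δ ∧ ∀ x₀ ∈ X, Metric.infDist x₀ G < δ → ConvergesTo F X G x₀

/-- `G` is globally asymptotically stable in the `ε`-`δ` sense. -/
def GloballyAsymptoticallyStable (G : Set (Vec n)) : Prop :=
  UniformlyStable F X G ∧ ∀ x₀ ∈ X, ConvergesTo F X G x₀

/-- The set `φ([0, ∞), S)` of points reached in forward time from initial conditions in `S`. -/
def forwardReach (S : Set (Vec n)) : Set (Vec n) :=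
  {y | ∃ x₀ ∈ S, ∃ c, IsTrajectory F X x₀ c ∧ ∃ t : ℝ, 0 ≤ t ∧ c t = y}

/-- All trajectories are bounded: they exist for all `t ≥ 0`, are bounded sets, and their closures
in `ℝⁿ` are contained in the state space `X`. The last condition is automatic if `X` is closed in
`ℝⁿ`, in particular if `X = ℝⁿ`. -/
def AllTrajectoriesBounded : Prop :=
  ∀ x₀ ∈ X, (∃ c, IsTrajectory F X x₀ c) ∧ Bornology.IsBounded (forwardReach F X {x₀}) ∧
    closure (forwardReach F X {x₀}) ⊆ X

/-- Local uniform boundedness near `G`: for each `x ∈ G` there are `l, r > 0` with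
`φ([0, ∞), B_l(x)) ⊆ B_r(x)`, the closure in `ℝⁿ` of `φ([0, ∞), B_l(x))` being contained in the
state space `X`. The last condition is automatic if `X` is closed in `ℝⁿ`, in particular if
`X = ℝⁿ`. -/
def LocallyUniformlyBoundedNear (G : Set (Vec n)) : Prop :=
  ∀ x ∈ G, ∃ l r : ℝ, 0 < l ∧ 0 < r ∧
    (∀ x₀ ∈ X ∩ Metric.ball x l, ∃ c, IsTrajectory F X x₀ c) ∧
    forwardReach F X (X ∩ Metric.ball x l) ⊆ Metric.ball x r ∧
    closure (forwardReach F X (X ∩ Metric.ball x l)) ⊆ X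

end Dynamics

/-! ### Control-affine systems -/

/-- `u : [0, ∞) → ℝᵐ` is piecewise continuous: on bounded intervals it has finitely many
discontinuities, and all one-sided limits exist. -/
def PiecewiseContinuous {m : ℕ} (u : ℝ → Vec m) : Prop :=
  (∀ T : ℝ, {t ∈ Icc 0 T | ¬ ContinuousWithinAt u (Ici 0) t}.Finite) ∧
    (∀ t : ℝ, 0 ≤ t → ∃ l, Tendsto u (𝓝[>] t) (𝓝 l)) ∧
    ∀ t : ℝ, 0 < t → ∃ l, Tendsto u (𝓝[<] t) (𝓝 l)

/-- A control-affine system `ẋ = f(x) + ∑ᵢ gᵢ(x) uᵢ`, `y = h(x)` with state space `X`, which is an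
open subset or a smooth submanifold of `ℝⁿ`, set of input values `U ⊆ ℝᵐ` and output in `ℝᵐ`. -/
structure ControlSystem (n m : ℕ) where
  X : Set (Vec n)
  U : Set (Vec m)
  f : Vec n → Vec n
  g : Fin m → Vec n → Vec n
  h : Vec n → Vec m
  submanifold : IsSmoothSubmanifold X
  smooth_f : IsSmoothVectorField X f
  smooth_g : ∀ i, IsSmoothVectorField X (g i)
  smooth_h : ContDiffOn ℝ ∞ h X

namespace ControlSystem

variable {n m : ℕ} (S : ControlSystem n m)

/-- `c` solves `ẋ = f(x) + ∑ᵢ gᵢ(x) uᵢ(t)` on `[0, T]` for the open-loop control `u`. -/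
def IsControlledSolution (u : ℝ → Vec m) (c : ℝ → Vec n) (T : ℝ) : Prop :=
  MapsTo c (Icc 0 T) S.X ∧ ContinuousOn c (Icc 0 T) ∧
    ∀ t ∈ Ioo 0 T, ContinuousAt u t →
      HasDerivAt c (S.f (c t) + ∑ i, u t i • S.g i (c t)) t

/-- The system is passive with storage function `V`: `V` is a nonnegative `C¹` function on `X` and
`V(x(T)) - V(x(0)) ≤ ∫₀ᵀ u(t)ᵀ y(t) dt` along all solutions, for all piecewise continuous controls
with values in `U`. -/
def IsPassiveWith (V : Vec n → ℝ) : Prop :=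
  ContDiffOn ℝ 1 V S.X ∧ (∀ x ∈ S.X, 0 ≤ V x) ∧
    ∀ (u : ℝ → Vec m) (c : ℝ → Vec n) (T : ℝ), PiecewiseContinuous u →
      (∀ t : ℝ, 0 ≤ t → u t ∈ S.U) → 0 ≤ T → S.IsControlledSolution u c T →
        V (c T) - V (c 0) ≤ ∫ t in (0 : ℝ)..T, inner ℝ (u t) (S.h (c t))

/-- `u = -p(x)` is a passivity-based feedback: `p` is smooth on `X`, the control values `-p(x)` are
admissible, `p(x) = 0` where `h(x) = 0`, and `h(x)ᵀ p(x) > 0` where `h(x) ≠ 0`. -/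
def IsPassivityBasedFeedback (p : Vec n → Vec m) : Prop :=
  ContDiffOn ℝ ∞ p S.X ∧ ∀ x ∈ S.X, -p x ∈ S.U ∧ (S.h x = 0 → p x = 0) ∧
    (S.h x ≠ 0 → 0 < inner ℝ (S.h x) (p x))

/-- The closed-loop vector field `f(x) + ∑ᵢ gᵢ(x) uᵢ` with `u = -p(x)`. -/
noncomputable def closedLoop (p : Vec n → Vec m) (x : Vec n) : Vec n :=
  S.f x + ∑ i, (-p x) i • S.g i x

/-- The maximal subset of `h⁻¹(0)` which is invariant for the open-loop system `ẋ = f(x)`. -/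
def maxInvariant : Set (Vec n) :=
  ⋃₀ {A | A ⊆ {x ∈ S.X | S.h x = 0} ∧ IsInvariantSet S.f S.X A}

/-- The system is locally `G`-detectable. -/
def LocallyDetectable (G : Set (Vec n)) : Prop :=
  SemiAsymptoticallyStableRel S.f S.X S.maxInvariant G

/-- The system is `G`-detectable. -/
def Detectable (G : Set (Vec n)) : Prop :=
  GloballySemiAsymptoticallyStableRel S.f S.X S.maxInvariant G

end ControlSystem

/-!
Write `φ` for the closed-loop flow, `O` for the maximal open-loop invariant subset of `h⁻¹(0)`.

The two systems coincide where `h = 0`, because the feedback vanishes there. Hence closed-loop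
solutions starting in `O` are open-loop solutions (`ControlSystem.f_solution_of_mem_maxInvariant`),
and stability of `G` for the closed loop restricts to stability relative to `O` for the open loop.
That is the easy implication.

For the converse, passivity makes `V` nonincreasing along `φ`, and `V` can only be constant where
`h = 0`. This gives two ways of producing points of `O`: limit points of closed-loop trajectories in
compact sets are in `O` by LaSalle's argument (`ControlSystem.exists_trajectory_of_limit_point`), and
so are backward closed-loop trajectories with `V = 0`
(`ControlSystem.mem_maxInvariant_of_backward`): forward in time the storage stays zero. Note that `G`
itself need not be contained in `O`.

*Stability* (`ControlSystem.exists_ball_stable`). If it fails at a point of `G`, there are solutions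
starting closer and closer to this point and reaching a fixed small distance `ε` from `G`. They stay
in a compact set (`IsLocallyTrapped`), and they take longer and longer, since `G` is positively
invariant (`IsFlowField.tendsto_exit_time`). Seen backward from the exit point they converge to a
backward trajectory `z`, starting at distance `ε` from `G`, on which `V = 0`; so `z` lies in `O`. The
backward limit points of `z` lie in `O` as well, hence are attracted by `G`, so `z` contains points
arbitrarily close to `G` from which the flow leads to `z 0`. Stability relative to `O` then puts
`z 0` closer to `G` than `ε` (`ControlSystem.infDist_lt_of_backward`).

*Attraction* (`ControlSystem.convergesTo_of_stable`). The limit points of a closed-loop trajectory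
in a compact set lie in `O`, hence are attracted by `G`; so the trajectory gets close to `G`, and by
stability it stays close.

The compact case and the locally uniformly bounded case differ only in the origin of the compact
set: a compact neighbourhood of `G` in `X`, or the closure of the set reached from a small ball.

The facts about flows on a submanifold `X` are collected in `IsFlowField`: local Lipschitz
continuity, and local existence, both obtained in straightening charts. Backward solutions are
treated as forward solutions of the reversed field.
-/

/-! ### Straightening charts and local flows on a submanifold -/

/-- `e` straightens `X` to the coordinate slice `{y | y i = 0 for all i ≥ d}`. -/
def IsSliceChart {n : ℕ} (X : Set (Vec n)) (d : ℕ) (e : OpenPartialHomeomorph (Vec n) (Vec n)) :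
    Prop :=
  ContDiffOn ℝ ∞ e e.source ∧ ContDiffOn ℝ ∞ e.symm e.target ∧
    ∀ z ∈ e.source, z ∈ X ↔ ∀ i : Fin n, d ≤ (i : ℕ) → e z i = 0

/-- The projection onto the first `d` coordinates, which sets all others to zero. -/
noncomputable def sliceProj (n d : ℕ) : Vec n →L[ℝ] Vec n :=
  LinearMap.toContinuousLinearMap
    { toFun := fun y => WithLp.toLp 2 fun i => if (i : ℕ) < d then y i else 0
      map_add' := fun x y => by ext i; by_cases h : (i : ℕ) < d <;> simp [h]
      map_smul' := fun a y => by ext i; by_cases h : (i : ℕ) < d <;> simp [h] }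

theorem sliceProj_apply {n d : ℕ} (y : Vec n) (i : Fin n) :
    sliceProj n d y i = if (i : ℕ) < d then y i else 0 := rfl

theorem sliceProj_eq_self_iff {n d : ℕ} {y : Vec n} :
    sliceProj n d y = y ↔ ∀ i : Fin n, d ≤ (i : ℕ) → y i = 0 := by
  constructor
  · intro h i hi
    rw [← h, sliceProj_apply, if_neg (not_lt.2 hi)]
  · intro h
    ext i
    rw [sliceProj_apply]
    split_ifs with hi
    · rfl
    · exact (h i (not_lt.1 hi)).symm

theorem sliceProj_idem {n d : ℕ} (y : Vec n) :
    sliceProj n d (sliceProj n d y) = sliceProj n d y :=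
  sliceProj_eq_self_iff.2 fun i hi => by rw [sliceProj_apply, if_neg (not_lt.2 hi)]

theorem IsSliceChart.sliceProj_eq {n d : ℕ} {X : Set (Vec n)}
    {e : OpenPartialHomeomorph (Vec n) (Vec n)} (he : IsSliceChart X d e) {x : Vec n}
    (hx : x ∈ e.source) (hxX : x ∈ X) : sliceProj n d (e x) = e x :=
  sliceProj_eq_self_iff.2 ((he.2.2 x hx).1 hxX)

theorem IsSliceChart.symm_mem {n d : ℕ} {X : Set (Vec n)}
    {e : OpenPartialHomeomorph (Vec n) (Vec n)} (he : IsSliceChart X d e) {y : Vec n}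
    (hy : y ∈ e.target) (hyd : sliceProj n d y = y) : e.symm y ∈ X := by
  rw [he.2.2 _ (e.map_target hy), e.right_inv hy]
  exact sliceProj_eq_self_iff.1 hyd

theorem IsSliceChart.contDiffAt {n d : ℕ} {X : Set (Vec n)}
    {e : OpenPartialHomeomorph (Vec n) (Vec n)} (he : IsSliceChart X d e) {x : Vec n}
    (hx : x ∈ e.source) : ContDiffAt ℝ ∞ e x :=
  he.1.contDiffAt (e.open_source.mem_nhds hx)

theorem IsSliceChart.contDiffAt_symm {n d : ℕ} {X : Set (Vec n)}
    {e : OpenPartialHomeomorph (Vec n) (Vec n)} (he : IsSliceChart X d e) {y : Vec n}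
    (hy : y ∈ e.target) : ContDiffAt ℝ ∞ e.symm y :=
  he.2.1.contDiffAt (e.open_target.mem_nhds hy)

/-- Tangency read in charts: every chart straightening `X` near `x` maps `v` to a vector of the
slice. Contrary to the description by velocities of curves, this is visibly linear in `v`. -/
def IsChartTangent {n : ℕ} (X : Set (Vec n)) (x v : Vec n) : Prop :=
  ∀ (d : ℕ) (e : OpenPartialHomeomorph (Vec n) (Vec n)), IsSliceChart X d e → x ∈ e.source →
    sliceProj n d (fderiv ℝ e x v) = fderiv ℝ e x v

theorem IsTangentVector.isChartTangent {n : ℕ} {X : Set (Vec n)} {x v : Vec n}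
    (h : IsTangentVector X x v) : IsChartTangent X x v := by
  intro d e he hx
  obtain ⟨c, rfl, hcX, hc⟩ := h
  have h1 : HasDerivAt (fun t => e (c t)) (fderiv ℝ e (c 0) v) 0 :=
    ((he.contDiffAt hx).differentiableAt (by simp)).hasFDerivAt.comp_hasDerivAt 0 hc
  have h2 : HasDerivAt (fun t => sliceProj n d (e (c t)))
      (sliceProj n d (fderiv ℝ e (c 0) v)) 0 :=
    (sliceProj n d).hasFDerivAt.comp_hasDerivAt 0 h1
  have hs : ∀ᶠ t in 𝓝 (0 : ℝ), c t ∈ e.source :=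
    hc.continuousAt.eventually (e.open_source.mem_nhds hx)
  refine h2.unique (h1.congr_of_eventuallyEq ?_)
  filter_upwards [hcX, hs] with t ht hts
  exact he.sliceProj_eq hts ht

theorem IsChartTangent.add {n : ℕ} {X : Set (Vec n)} {x v w : Vec n}
    (hv : IsChartTangent X x v) (hw : IsChartTangent X x w) : IsChartTangent X x (v + w) :=
  fun d e he hx => by rw [map_add, map_add, hv d e he hx, hw d e he hx]

theorem IsChartTangent.smul {n : ℕ} {X : Set (Vec n)} {x v : Vec n} (a : ℝ)
    (hv : IsChartTangent X x v) : IsChartTangent X x (a • v) :=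
  fun d e he hx => by rw [map_smul, map_smul, hv d e he hx]

theorem IsChartTangent.neg {n : ℕ} {X : Set (Vec n)} {x v : Vec n}
    (hv : IsChartTangent X x v) : IsChartTangent X x (-v) :=
  fun d e he hx => by rw [map_neg, map_neg, hv d e he hx]

theorem IsChartTangent.sum {n : ℕ} {X : Set (Vec n)} {x : Vec n} {ι : Type*} (s : Finset ι)
    {v : ι → Vec n} (hv : ∀ i, IsChartTangent X x (v i)) : IsChartTangent X x (∑ i ∈ s, v i) :=
  fun d e he hx => by
    rw [map_sum, map_sum]; exact Finset.sum_congr rfl fun i _ => hv i d e he hx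

/-- What the theory of `ẋ = F x` on `X` needs: uniqueness (`F` is locally Lipschitz on `X`) and
existence in forward time, for a time that is locally uniform in the initial condition. -/
structure IsFlowField {n : ℕ} (F : Vec n → Vec n) (X : Set (Vec n)) : Prop where
  locallyLipschitzOn : LocallyLipschitzOn X F
  exists_solution : ∀ x ∈ X, ∃ U ∈ 𝓝 x, ∃ r : ℝ, 0 < r ∧ ∀ y ∈ X ∩ U,
    ∃ c : ℝ → Vec n, c 0 = y ∧ IsSolutionOn F X c (Icc 0 r)

/-- The local flow of a `C¹` vector field, with a common existence time and inside a given
neighbourhood `W` of the base point. -/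
theorem ContDiffAt.exists_local_flow {E : Type*} [NormedAddCommGroup E] [NormedSpace ℝ E]
    [CompleteSpace E] {H : E → E} {y₀ : E} (hH : ContDiffAt ℝ 1 H y₀) {W : Set E}
    (hW : W ∈ 𝓝 y₀) :
    ∃ U ∈ 𝓝 y₀, ∃ r : ℝ, 0 < r ∧ ∀ y ∈ U, ∃ a : ℝ → E, a 0 = y ∧
      ∀ t ∈ Icc 0 r, a t ∈ W ∧ HasDerivWithinAt a (H (a t)) (Icc 0 r) t := by
  obtain ⟨ε, hε, a, r, L, K, hr, hpl⟩ := IsPicardLindelof.of_contDiffAt_one hH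
  obtain ⟨α, hα, hαc⟩ :=
    (hpl 0).exists_forall_mem_closedBall_eq_hasDerivWithinAt_continuousOn
  have hnhds : Metric.closedBall y₀ r ×ˢ Icc (0 - ε) (0 + ε) ∈ 𝓝 ((y₀, 0) : E × ℝ) :=
    prod_mem_nhds (Metric.closedBall_mem_nhds _ (by exact_mod_cast hr))
      (Icc_mem_nhds (by linarith) (by linarith))
  have hcont : ContinuousAt α (y₀, 0) := hαc.continuousAt hnhds
  have h0 : α (y₀, 0) = y₀ := (hα y₀ (Metric.mem_closedBall_self r.2)).1
  have hpre : α ⁻¹' W ∈ 𝓝 ((y₀, 0) : E × ℝ) := hcont (by rwa [h0])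
  obtain ⟨U, hU, J, hJ, hUJ⟩ := mem_nhds_prod_iff.1 (inter_mem hnhds hpre)
  obtain ⟨δ, hδ, hδJ⟩ := Metric.mem_nhds_iff.1 hJ
  refine ⟨U, hU, δ / 2, by linarith, fun y hy => ⟨fun t => α (y, t), ?_, fun t ht => ?_⟩⟩
  · exact (hα y (hUJ (mk_mem_prod hy (mem_of_mem_nhds hJ))).1.1).1
  · have hsub : Icc 0 (δ / 2) ⊆ J := fun s hs => hδJ (by
      rw [Metric.mem_ball, Real.dist_eq, sub_zero, abs_of_nonneg hs.1]; linarith [hs.2])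
    have hmem := fun s (hs : s ∈ Icc 0 (δ / 2)) => hUJ (mk_mem_prod hy (hsub hs))
    refine ⟨(hmem t ht).2, ?_⟩
    exact ((hα y (hmem t ht).1.1).2 t (hmem t ht).1.2).mono fun s hs => (hmem s hs).1.2

/-- A smooth tangent field on a submanifold has a local flow: in a straightening chart the field is
the restriction to the slice of a `C¹` field with values in the slice, whose integral curves starting
in the slice stay there. -/
theorem IsSmoothSubmanifold.isFlowField {n : ℕ} {X : Set (Vec n)} (hX : IsSmoothSubmanifold X)
    {F : Vec n → Vec n} (hF : ContDiffOn ℝ ∞ F X) (hFX : ∀ x ∈ X, IsChartTangent X x (F x)) :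
    IsFlowField F X := by
  obtain ⟨d, hX⟩ := hX
  -- `F` read in the chart and extended by the projection to the slice
  have key : ∀ x ∈ X, ∃ e, x ∈ e.source ∧ IsSliceChart X d e ∧
      ContDiffAt ℝ ∞ (fun y => e.symm (sliceProj n d y)) (e x) ∧
      ContDiffAt ℝ ∞ (fun y => F (e.symm (sliceProj n d y))) (e x) := by
    intro x hx
    obtain ⟨e, hxe, he⟩ := hX x hx
    have he : IsSliceChart X d e := he
    have hP : sliceProj n d (e x) = e x := he.sliceProj_eq hxe hx
    have h1 : ContDiffAt ℝ ∞ (fun y => e.symm (sliceProj n d y)) (e x) :=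
      ContDiffAt.comp (e x) (by rw [hP]; exact he.contDiffAt_symm (e.map_source hxe))
        (sliceProj n d).contDiff.contDiffAt
    refine ⟨e, hxe, he, h1, ?_⟩
    have h2 : ContDiffWithinAt ℝ ∞ F X (e.symm (sliceProj n d (e x))) := by
      rw [hP, e.left_inv hxe]; exact hF x hx
    have hU : sliceProj n d ⁻¹' e.target ∈ 𝓝 (e x) :=
      (sliceProj n d).continuous.continuousAt
        (by rw [hP]; exact e.open_target.mem_nhds (e.map_source hxe))
    have h3 : ContDiffWithinAt ℝ ∞ (F ∘ fun y => e.symm (sliceProj n d y))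
        (sliceProj n d ⁻¹' e.target) (e x) :=
      h2.comp (e x) h1.contDiffWithinAt fun y hy => he.symm_mem hy (sliceProj_idem y)
    exact h3.contDiffAt hU
  refine ⟨fun x hx => ?_, fun x hx => ?_⟩
  · obtain ⟨e, hxe, he, -, hFe⟩ := key x hx
    obtain ⟨K, s, hs, hK⟩ := (hFe.of_le (by simp)).exists_lipschitzOnWith
    obtain ⟨K', s', hs', hK'⟩ :=
      ((he.contDiffAt hxe).of_le (by simp)).exists_lipschitzOnWith
    have hes : e ⁻¹' s ∈ 𝓝 x := (he.contDiffAt hxe).continuousAt hs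
    refine ⟨K * K', X ∩ (s' ∩ (e ⁻¹' s ∩ e.source)), ?_, ?_⟩
    · exact inter_mem_nhdsWithin X
        (inter_mem hs' (inter_mem hes (e.open_source.mem_nhds hxe)))
    · have := (hK.comp (hK'.mono (s := X ∩ (s' ∩ (e ⁻¹' s ∩ e.source)))
        fun z hz => hz.2.1)) fun z hz => hz.2.2.1
      intro y hy z hz
      have h := this hy hz
      simp only [Function.comp] at h
      rwa [he.sliceProj_eq hy.2.2.2 hy.1, he.sliceProj_eq hz.2.2.2 hz.1,
        e.left_inv hy.2.2.2, e.left_inv hz.2.2.2] at h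
  · obtain ⟨e, hxe, he, hse, hFe⟩ := key x hx
    have hP : sliceProj n d (e x) = e x := he.sliceProj_eq hxe hx
    set H : Vec n → Vec n := fun y => sliceProj n d
      (fderiv ℝ e (e.symm (sliceProj n d y)) (F (e.symm (sliceProj n d y)))) with hH
    have hD : ContDiffAt ℝ 1 (fun y => fderiv ℝ e (e.symm (sliceProj n d y))) (e x) := by
      refine ContDiffAt.comp (e x) ?_ (hse.of_le (by simp))
      rw [hP, e.left_inv hxe]
      exact (he.contDiffAt hxe).fderiv_right (by norm_cast)
    have hHc : ContDiffAt ℝ 1 H (e x) :=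
      (sliceProj n d).contDiff.contDiffAt.comp (e x) (hD.clm_apply (hFe.of_le (by simp)))
    obtain ⟨U, hU, r, hr, hflow⟩ :=
      hHc.exists_local_flow (e.open_target.mem_nhds (e.map_source hxe))
    refine ⟨e.source ∩ e ⁻¹' U, inter_mem (e.open_source.mem_nhds hxe)
      ((he.contDiffAt hxe).continuousAt hU), r, hr, ?_⟩
    rintro y ⟨hyX, hye, hyU⟩
    obtain ⟨a, ha0, ha⟩ := hflow (e y) hyU
    -- the component of `a` transversal to the slice is constant
    have hslice : ∀ t ∈ Icc 0 r, sliceProj n d (a t) = a t := by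
      have hder : ∀ t ∈ Icc 0 r,
          HasDerivWithinAt (fun t => sliceProj n d (a t) - a t) 0 (Icc 0 r) t := by
        intro t ht
        have h1 := (sliceProj n d).hasFDerivAt.comp_hasDerivWithinAt t (ha t ht).2
        have h2 := h1.sub (ha t ht).2
        rwa [hH, sliceProj_idem, sub_self] at h2
      intro t ht
      have := constant_of_has_deriv_right_zero (fun t ht => (hder t ht).continuousWithinAt)
        (fun t ht => (hder t (Ico_subset_Icc_self ht)).mono_of_mem_nhdsWithin
          (Icc_mem_nhdsGE_of_mem ht)) t ht
      rw [ha0, he.sliceProj_eq hye hyX, sub_self, sub_eq_zero] at this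
      exact this
    refine ⟨fun t => e.symm (a t), by simp only [ha0, e.left_inv hye], ?_, ?_⟩
    · exact fun t ht => he.symm_mem (ha t ht).1 (hslice t ht)
    · intro t ht
      have hat := (ha t ht).1
      have hcX : e.symm (a t) ∈ X := he.symm_mem hat (hslice t ht)
      have hcs : e.symm (a t) ∈ e.source := e.map_target hat
      have hda : HasDerivWithinAt a (fderiv ℝ e (e.symm (a t)) (F (e.symm (a t))))
          (Icc 0 r) t := by
        have := (ha t ht).2
        rw [hH] at this
        simp only [hslice t ht] at this
        rwa [hFX _ hcX d e he hcs] at this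
      have hsd := ((he.contDiffAt_symm hat).differentiableAt (by simp)).hasFDerivAt
      have hed : HasFDerivAt e (fderiv ℝ e (e.symm (a t))) (e.symm (a t)) :=
        ((he.contDiffAt hcs).differentiableAt (by simp)).hasFDerivAt
      have hcomp : HasFDerivAt (fun z => e.symm (e z))
          ((fderiv ℝ e.symm (a t)).comp (fderiv ℝ e (e.symm (a t)))) (e.symm (a t)) := by
        refine HasFDerivAt.comp _ ?_ hed
        rwa [e.right_inv hat]
      have hid : (fderiv ℝ e.symm (a t)).comp (fderiv ℝ e (e.symm (a t))) =
          ContinuousLinearMap.id ℝ (Vec n) := by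
        refine hcomp.unique ((hasFDerivAt_id _).congr_of_eventuallyEq ?_)
        filter_upwards [e.open_source.mem_nhds hcs] with z hz
        exact e.left_inv hz
      have h3 := hsd.comp_hasDerivWithinAt t hda
      have h4 := congrArg (fun A : Vec n →L[ℝ] Vec n => A (F (e.symm (a t)))) hid
      simp only [ContinuousLinearMap.comp_apply, ContinuousLinearMap.id_apply] at h4
      rwa [h4] at h3

/-- A compact subset of a submanifold has a compact neighbourhood in it. -/
theorem IsSmoothSubmanifold.exists_compact_nhds {n : ℕ} {X : Set (Vec n)}
    (hX : IsSmoothSubmanifold X) {A : Set (Vec n)} (hA : IsCompact A) (hAX : A ⊆ X) :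
    ∃ K U : Set (Vec n), IsCompact K ∧ K ⊆ X ∧ IsOpen U ∧ A ⊆ U ∧ X ∩ U ⊆ K := by
  obtain ⟨d, hX⟩ := hX
  have hloc : ∀ x ∈ X, ∃ r : ℝ, 0 < r ∧ IsCompact (X ∩ Metric.closedBall x r) := by
    intro x hx
    obtain ⟨e, hxe, he⟩ := hX x hx
    have he : IsSliceChart X d e := he
    obtain ⟨r, hr, hrs⟩ := Metric.nhds_basis_closedBall.mem_iff.1 (e.open_source.mem_nhds hxe)
    refine ⟨r, hr, ?_⟩
    have heq : X ∩ Metric.closedBall x r =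
        Metric.closedBall x r ∩ e ⁻¹' {y | sliceProj n d y = y} := by
      ext z
      constructor
      · exact fun hz => ⟨hz.2, he.sliceProj_eq (hrs hz.2) hz.1⟩
      · exact fun hz => ⟨(he.2.2 z (hrs hz.1)).2 (sliceProj_eq_self_iff.1 hz.2), hz.1⟩
    rw [heq]
    refine (isCompact_closedBall x r).of_isClosed_subset ?_ inter_subset_left
    exact (e.continuousOn.mono hrs).preimage_isClosed_of_isClosed Metric.isClosed_closedBall
      (isClosed_eq (sliceProj n d).continuous continuous_id)
  refine hA.induction_on (p := fun A => ∃ K U : Set (Vec n), IsCompact K ∧ K ⊆ X ∧ IsOpen U ∧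
    A ⊆ U ∧ X ∩ U ⊆ K) ?_ ?_ ?_ ?_
  · exact ⟨∅, ∅, isCompact_empty, empty_subset _, isOpen_empty, le_rfl, by simp⟩
  · rintro s t hst ⟨K, U, hK, hKX, hU, htU, hUK⟩
    exact ⟨K, U, hK, hKX, hU, hst.trans htU, hUK⟩
  · rintro s t ⟨K, U, hK, hKX, hU, hsU, hUK⟩ ⟨K', U', hK', hKX', hU', htU, hUK'⟩
    refine ⟨K ∪ K', U ∪ U', hK.union hK', union_subset hKX hKX', hU.union hU',
      union_subset_union hsU htU, ?_⟩
    rw [inter_union_distrib_left]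
    exact union_subset_union hUK hUK'
  · intro x hx
    obtain ⟨r, hr, hK⟩ := hloc x (hAX hx)
    exact ⟨Metric.ball x r, mem_nhdsWithin_of_mem_nhds (Metric.ball_mem_nhds x hr),
      X ∩ Metric.closedBall x r, Metric.ball x r, hK, inter_subset_left, Metric.isOpen_ball,
      le_rfl, inter_subset_inter_right X Metric.ball_subset_closedBall⟩

/-! ### Solutions of autonomous differential equations -/

section Solutions

variable {n : ℕ} {F : Vec n → Vec n} {X K : Set (Vec n)} {c d : ℝ → Vec n} {J J' : Set ℝ} {a : ℝ}

theorem IsSolutionOn.mono (hc : IsSolutionOn F X c J) (hJ : J' ⊆ J) : IsSolutionOn F X c J' :=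
  ⟨hc.1.mono_left hJ, hc.2.mono hJ⟩

theorem IsSolutionOn.mono_space (hc : IsSolutionOn F K c J) (hK : K ⊆ X) : IsSolutionOn F X c J :=
  ⟨hc.1.mono_right hK, hc.2⟩

theorem IsSolutionOn.continuousOn (hc : IsSolutionOn F X c J) : ContinuousOn c J :=
  hc.2.continuousOn

theorem IsSolutionOn.congr (hc : IsSolutionOn F X c J) (h : EqOn d c J) :
    IsSolutionOn F X d J :=
  ⟨fun t ht => by rw [h ht]; exact hc.1 ht,
    fun t ht => by rw [h ht]; exact (hc.2 t ht).congr h (h ht)⟩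

theorem IsSolutionOn.congr_field {F' : Vec n → Vec n} (hc : IsSolutionOn F X c J)
    (h : ∀ t ∈ J, F (c t) = F' (c t)) : IsSolutionOn F' X c J :=
  ⟨hc.1, fun t ht => (hc.2 t ht).congr_deriv (h t ht)⟩

theorem IsSolutionOn.shift (hc : IsSolutionOn F X c J) (a : ℝ) (h : ∀ t ∈ J', t + a ∈ J) :
    IsSolutionOn F X (fun t => c (t + a)) J' := by
  refine ⟨fun t ht => hc.1 (h t ht), fun t ht => ?_⟩
  have := HasDerivWithinAt.scomp t (hc.2 (t + a) (h t ht))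
    ((hasDerivAt_id t).add_const a).hasDerivWithinAt h
  simpa [Function.comp_def] using this

theorem IsSolutionOn.reverse (hc : IsSolutionOn F X c J) (a : ℝ) (h : ∀ t ∈ J', a - t ∈ J) :
    IsSolutionOn (-F) X (fun t => c (a - t)) J' := by
  refine ⟨fun t ht => hc.1 (h t ht), fun t ht => ?_⟩
  have := HasDerivWithinAt.scomp t (hc.2 (a - t) (h t ht))
    ((hasDerivAt_id t).const_sub a).hasDerivWithinAt h
  simpa [Function.comp_def] using this

/-- Two solutions, one up to time `a` and one from time `a` on, which agree at time `a` are
concatenated to one solution. -/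
theorem IsSolutionOn.glue (hc : IsSolutionOn F X c J) (hd : IsSolutionOn F X d J')
    (hJ : J ⊆ Iic a) (hJ' : J' ⊆ Ici a) (ha : a ∈ J) (ha' : a ∈ J') (had : c a = d a) :
    IsSolutionOn F X (fun t => if t ≤ a then c t else d t) (J ∪ J') := by
  set e : ℝ → Vec n := fun t => if t ≤ a then c t else d t with he
  have hec : EqOn e c J := fun t ht => if_pos (hJ ht)
  have hed : EqOn e d J' := by
    intro t ht
    by_cases h : t ≤ a
    · obtain rfl : t = a := le_antisymm h (hJ' ht)
      rw [he]; simp [had]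
    · exact if_neg h
  have h1 := hc.congr hec
  have h2 := hd.congr hed
  refine ⟨h1.1.union h2.1, fun t ht => ?_⟩
  rcases lt_trichotomy t a with h | rfl | h
  · have htJ : t ∈ J := ht.resolve_right fun h' => absurd (hJ' h') (not_le.2 h)
    refine (h1.2 t htJ).mono_of_mem_nhdsWithin ?_
    filter_upwards [self_mem_nhdsWithin, mem_nhdsWithin_of_mem_nhds (Iio_mem_nhds h)] with s hs hsa
    exact hs.resolve_right fun h' => absurd (show a ≤ s from hJ' h') (not_le.2 hsa)
  · exact (h1.2 t ha).union (h2.2 t ha')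
  · have htJ : t ∈ J' := ht.resolve_left fun h' => absurd (hJ h') (not_le.2 h)
    refine (h2.2 t htJ).mono_of_mem_nhdsWithin ?_
    filter_upwards [self_mem_nhdsWithin, mem_nhdsWithin_of_mem_nhds (Ioi_mem_nhds h)] with s hs hsa
    exact hs.resolve_left fun h' => absurd (show s ≤ a from hJ h') (not_le.2 hsa)

theorem isSolutionOn_Ici_of_forall (h : ∀ T : ℝ, 0 ≤ T → IsSolutionOn F X c (Icc 0 T)) :
    IsSolutionOn F X c (Ici 0) := by
  refine ⟨fun t ht => (h t ht).1 ⟨ht, le_rfl⟩, fun t ht => ?_⟩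
  have ht : (0 : ℝ) ≤ t := ht
  refine ((h (t + 1) (by linarith)).2 t ⟨ht, by linarith⟩).mono_of_mem_nhdsWithin ?_
  filter_upwards [self_mem_nhdsWithin,
    mem_nhdsWithin_of_mem_nhds (Iio_mem_nhds (show t < t + 1 by linarith))] with s hs hst
  exact ⟨hs, hst.le⟩

theorem isSolutionOn_singleton {x : Vec n} (hx : x ∈ X) (a : ℝ) :
    IsSolutionOn F X (fun _ => x) {a} := by
  refine ⟨fun _ _ => hx, fun t ht => ?_⟩
  rw [mem_singleton_iff.1 ht]
  exact HasFDerivWithinAt.of_subsingleton subsingleton_singleton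

theorem LocallyLipschitzOn.neg_field (hF : LocallyLipschitzOn X F) : LocallyLipschitzOn X (-F) :=
  fun _ hx => by
    obtain ⟨L, t, ht, h⟩ := hF hx
    exact ⟨L, t, ht, fun x hx y hy => by simpa [edist_neg_neg] using h hx hy⟩

/-- Continuous dependence on initial conditions for solutions in a compact set. -/
theorem exists_dist_solution_le (hF : LocallyLipschitzOn X F) (hK : IsCompact K) (hKX : K ⊆ X) :
    ∃ L : ℝ, 0 ≤ L ∧ ∀ (T : ℝ) (c d : ℝ → Vec n), IsSolutionOn F K c (Icc 0 T) →
      IsSolutionOn F K d (Icc 0 T) → ∀ t ∈ Icc 0 T,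
        dist (c t) (d t) ≤ dist (c 0) (d 0) * Real.exp (L * t) := by
  obtain ⟨L, hL⟩ := (hF.mono hKX).exists_lipschitzOnWith_of_compact hK
  refine ⟨L, L.2, fun T c d hc hd t ht => ?_⟩
  have hder : ∀ c : ℝ → Vec n, IsSolutionOn F K c (Icc 0 T) →
      ∀ t ∈ Ico 0 T, HasDerivWithinAt c (F (c t)) (Ici t) t := fun c hc t ht =>
    (hc.2 t (Ico_subset_Icc_self ht)).mono_of_mem_nhdsWithin (Icc_mem_nhdsGE_of_mem ht)
  have := dist_le_of_trajectories_ODE_of_mem (v := fun _ => F) (s := fun _ => K) (K := L)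
    (fun _ _ => hL) hc.continuousOn (hder c hc) (fun t ht => hc.1 (Ico_subset_Icc_self ht))
    hd.continuousOn (hder d hd) (fun t ht => hd.1 (Ico_subset_Icc_self ht)) le_rfl t ht
  rwa [sub_zero] at this

/-- Restriction of the state space to the points that a solution on a compact interval visits. -/
theorem IsSolutionOn.image (hc : IsSolutionOn F X c J) : IsSolutionOn F (c '' J) c J :=
  ⟨mapsTo_image c J, hc.2⟩

theorem IsSolutionOn.isCompact_image {T : ℝ} (hc : IsSolutionOn F X c (Icc 0 T)) :
    IsCompact (c '' Icc 0 T) :=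
  isCompact_Icc.image_of_continuousOn hc.continuousOn

theorem IsSolutionOn.eqOn_Icc (hF : LocallyLipschitzOn X F) {T : ℝ}
    (hc : IsSolutionOn F X c (Icc 0 T)) (hd : IsSolutionOn F X d (Icc 0 T)) (h0 : c 0 = d 0) :
    EqOn c d (Icc 0 T) := by
  obtain ⟨L, -, hL⟩ := exists_dist_solution_le hF (hc.isCompact_image.union hd.isCompact_image)
    (union_subset hc.1.image_subset hd.1.image_subset)
  intro t ht
  have := hL T c d (hc.image.mono_space subset_union_left) (hd.image.mono_space subset_union_right)
    t ht
  rwa [h0, dist_self, zero_mul, dist_le_zero] at this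

/-- Uniqueness of solutions, forward and backward in time. -/
theorem IsSolutionOn.eqOn (hF : LocallyLipschitzOn X F) (hJ : J.OrdConnected) (h0J : (0 : ℝ) ∈ J)
    (hc : IsSolutionOn F X c J) (hd : IsSolutionOn F X d J) (h0 : c 0 = d 0) : EqOn c d J := by
  intro t ht
  rcases le_total 0 t with h | h
  · have hsub : Icc 0 t ⊆ J := hJ.out h0J ht
    exact (hc.mono hsub).eqOn_Icc hF (hd.mono hsub) h0 ⟨h, le_rfl⟩
  · have hsub : ∀ s ∈ Icc 0 (-t), 0 - s ∈ J := fun s hs =>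
      hJ.out ht h0J ⟨by linarith [hs.2], by linarith [hs.1]⟩
    have := (hc.reverse 0 hsub).eqOn_Icc hF.neg_field (hd.reverse 0 hsub) (by simpa using h0)
      (show -t ∈ Icc 0 (-t) from ⟨by linarith, le_rfl⟩)
    simpa using this

/-- Solutions starting in a compact set have a common existence time. -/
theorem IsFlowField.exists_uniform_time (hF : IsFlowField F X) (hK : IsCompact K) (hKX : K ⊆ X) :
    ∃ r : ℝ, 0 < r ∧ ∀ x ∈ K, ∃ c : ℝ → Vec n, c 0 = x ∧ IsSolutionOn F X c (Icc 0 r) := by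
  refine hK.induction_on (p := fun A => ∃ r : ℝ, 0 < r ∧ ∀ x ∈ A, ∃ c : ℝ → Vec n,
    c 0 = x ∧ (x ∈ X → IsSolutionOn F X c (Icc 0 r))) ⟨1, one_pos, by simp⟩ ?_ ?_ ?_ |>.imp
      fun r hr => ⟨hr.1, fun x hx => (hr.2 x hx).imp fun c hc => ⟨hc.1, hc.2 (hKX hx)⟩⟩
  · rintro s t hst ⟨r, hr, h⟩
    exact ⟨r, hr, fun x hx => h x (hst hx)⟩
  · rintro s t ⟨r, hr, h⟩ ⟨r', hr', h'⟩
    refine ⟨min r r', lt_min hr hr', ?_⟩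
    rintro x (hx | hx)
    · obtain ⟨c, hc, hcs⟩ := h x hx
      exact ⟨c, hc, fun hX => (hcs hX).mono (Icc_subset_Icc_right (min_le_left _ _))⟩
    · obtain ⟨c, hc, hcs⟩ := h' x hx
      exact ⟨c, hc, fun hX => (hcs hX).mono (Icc_subset_Icc_right (min_le_right _ _))⟩
  · intro x hx
    obtain ⟨U, hU, r, hr, h⟩ := hF.exists_solution x (hKX hx)
    refine ⟨U, mem_nhdsWithin_of_mem_nhds hU, r, hr, fun y hy => ?_⟩
    by_cases hyX : y ∈ X
    · obtain ⟨c, hc, hcs⟩ := h y ⟨hyX, hy⟩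
      exact ⟨c, hc, fun _ => hcs⟩
    · exact ⟨fun _ => y, rfl, fun h => absurd h hyX⟩

/-- A solution which cannot leave the compact set `K` exists for all `t ≥ 0`. -/
theorem IsFlowField.escape_or_trajectory (hF : IsFlowField F X) (hK : IsCompact K) (hKX : K ⊆ X)
    {x₀ : Vec n} (hx₀ : x₀ ∈ X) :
    (∃ T : ℝ, 0 ≤ T ∧ ∃ c, c 0 = x₀ ∧ IsSolutionOn F X c (Icc 0 T) ∧ c T ∉ K) ∨
      ∃ c, c 0 = x₀ ∧ IsSolutionOn F K c (Ici 0) := by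
  rw [or_iff_not_imp_left]
  intro h
  push Not at h
  obtain ⟨r, hr, hloc⟩ := hF.exists_uniform_time hK hKX
  have hex : ∀ k : ℕ, ∃ c, c 0 = x₀ ∧ IsSolutionOn F X c (Icc 0 (k * r)) := by
    intro k
    induction k with
    | zero =>
      refine ⟨fun _ => x₀, rfl, ?_⟩
      simpa using isSolutionOn_singleton (F := F) hx₀ 0
    | succ k ih =>
      obtain ⟨c, hc0, hc⟩ := ih
      have hkr : 0 ≤ (k : ℝ) * r := by positivity
      obtain ⟨d, hd0, hd⟩ := hloc _ (h _ hkr c hc0 hc)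
      have hd' : IsSolutionOn F X (fun t => d (t + -(k * r))) (Icc (k * r) ((k + 1) * r)) :=
        hd.shift _ fun t ht => ⟨by linarith [ht.1], by linarith [ht.2]⟩
      refine ⟨_, ?_, (hc.glue hd' (fun t ht => ht.2) (fun t ht => ht.1) ⟨hkr, le_rfl⟩
        ⟨le_rfl, by nlinarith⟩ (by simp [hd0])).mono ?_⟩
      · rw [if_pos hkr, hc0]
      · push_cast
        rw [Icc_union_Icc_eq_Icc hkr (by nlinarith)]
  choose c hc0 hc using hex
  have hceil : ∀ t : ℝ, t ≤ ⌈t / r⌉₊ * r := fun t => (div_le_iff₀ hr).1 (Nat.le_ceil _)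
  refine ⟨fun t => c ⌈t / r⌉₊ t, hc0 _, isSolutionOn_Ici_of_forall fun T hT => ?_⟩
  have hT' := hceil T
  have heq : EqOn (fun t => c ⌈t / r⌉₊ t) (c ⌈T / r⌉₊) (Icc 0 T) := by
    intro t ht
    exact ((hc _).mono (Icc_subset_Icc_right (hceil t))).eqOn_Icc hF.locallyLipschitzOn
      ((hc _).mono (Icc_subset_Icc_right (ht.2.trans hT'))) ((hc0 _).trans (hc0 _).symm)
      ⟨ht.1, le_rfl⟩
  have hsol := ((hc ⌈T / r⌉₊).mono (Icc_subset_Icc_right hT')).congr heq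
  exact ⟨fun t ht => h t ht.1 (fun t => c ⌈t / r⌉₊ t) (hc0 _)
    (hsol.mono (Icc_subset_Icc_right ht.2)), hsol.2⟩

/-- Solutions in a compact set on longer and longer intervals, with converging initial conditions,
converge to a trajectory in that set. -/
theorem IsFlowField.exists_limit_trajectory (hF : IsFlowField F X) (hK : IsCompact K) (hKX : K ⊆ X)
    {z : ℕ → ℝ → Vec n} {T : ℕ → ℝ} (hT : Tendsto T atTop atTop)
    (hz : ∀ k, IsSolutionOn F K (z k) (Icc 0 (T k))) {y : Vec n}
    (hy : Tendsto (fun k => z k 0) atTop (𝓝 y)) :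
    ∃ c, c 0 = y ∧ IsSolutionOn F K c (Ici 0) ∧
      ∀ s : ℝ, 0 ≤ s → Tendsto (fun k => z k s) atTop (𝓝 (c s)) := by
  have hyK : y ∈ K := hK.isClosed.mem_of_tendsto hy <| by
    filter_upwards [hT.eventually_ge_atTop 0] with k hk
    exact (hz k).1 ⟨le_rfl, hk⟩
  have hlim : ∀ (S : ℝ) (c : ℝ → Vec n), 0 ≤ S → c 0 = y → IsSolutionOn F X c (Icc 0 S) →
      Tendsto (fun k => z k S) atTop (𝓝 (c S)) := by
    intro S c hS hc0 hc
    obtain ⟨L, -, hL⟩ := exists_dist_solution_le hF.locallyLipschitzOn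
      (hK.union hc.isCompact_image) (union_subset hKX hc.1.image_subset)
    rw [tendsto_iff_dist_tendsto_zero] at hy ⊢
    have hlim0 : Tendsto (fun k => dist (z k 0) y * Real.exp (L * S)) atTop (𝓝 0) := by
      simpa using hy.mul_const (Real.exp (L * S))
    refine squeeze_zero' (Eventually.of_forall fun _ => dist_nonneg) ?_ hlim0
    filter_upwards [hT.eventually_ge_atTop S] with k hk
    rw [← hc0]
    exact hL S (z k) c (((hz k).mono (Icc_subset_Icc_right hk)).mono_space subset_union_left)
      (hc.image.mono_space subset_union_right) S ⟨hS, le_rfl⟩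
  have hmem : ∀ (S : ℝ) (x : Vec n), 0 ≤ S → Tendsto (fun k => z k S) atTop (𝓝 x) → x ∈ K := by
    intro S x hS hx
    refine hK.isClosed.mem_of_tendsto hx ?_
    filter_upwards [hT.eventually_ge_atTop S] with k hk
    exact (hz k).1 ⟨hS, hk⟩
  rcases hF.escape_or_trajectory hK hKX (hKX hyK) with ⟨S, hS, c, hc0, hc, hcK⟩ | ⟨c, hc0, hc⟩
  · exact absurd (hmem S _ hS (hlim S c hS hc0 hc)) hcK
  · exact ⟨c, hc0, hc, fun s hs =>
      hlim s c hs hc0 ((hc.mono_space hKX).mono fun t ht => ht.1)⟩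

end Solutions

/-! ### Passivity along the closed loop -/

theorem Continuous.piecewiseContinuous {m : ℕ} {u : ℝ → Vec m} (hu : Continuous u) :
    PiecewiseContinuous u := by
  refine ⟨fun T => ?_, fun t _ => ⟨u t, hu.continuousWithinAt.tendsto⟩,
    fun t _ => ⟨u t, hu.continuousWithinAt.tendsto⟩⟩
  convert! Set.finite_empty
  ext t
  simp [hu.continuousWithinAt]

namespace ControlSystem

variable {n m : ℕ} {S : ControlSystem n m} {V : Vec n → ℝ} {p : Vec n → Vec m} {G : Set (Vec n)}
  {c : ℝ → Vec n} {J : Set ℝ} {T : ℝ} {x : Vec n}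

theorem isFlowField_f (S : ControlSystem n m) : IsFlowField S.f S.X :=
  S.submanifold.isFlowField S.smooth_f.1 fun x hx => (S.smooth_f.2 x hx).isChartTangent

theorem contDiffOn_closedLoop (hp : S.IsPassivityBasedFeedback p) :
    ContDiffOn ℝ ∞ (S.closedLoop p) S.X := by
  refine S.smooth_f.1.add (ContDiffOn.sum fun i _ => ?_)
  have h : ContDiffOn ℝ ∞ (fun x => (-p x) i) S.X :=
    (EuclideanSpace.proj i : Vec m →L[ℝ] ℝ).contDiff.comp_contDiffOn hp.1.neg
  exact h.smul (S.smooth_g i).1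

theorem isChartTangent_closedLoop (S : ControlSystem n m) (p : Vec n → Vec m) (hx : x ∈ S.X) :
    IsChartTangent S.X x (S.closedLoop p x) :=
  (S.smooth_f.2 x hx).isChartTangent.add
    (.sum _ fun i => ((S.smooth_g i).2 x hx).isChartTangent.smul _)

theorem isFlowField_closedLoop (hp : S.IsPassivityBasedFeedback p) :
    IsFlowField (S.closedLoop p) S.X :=
  S.submanifold.isFlowField (contDiffOn_closedLoop hp)
    fun _ hx => S.isChartTangent_closedLoop p hx

theorem isFlowField_neg_closedLoop (hp : S.IsPassivityBasedFeedback p) :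
    IsFlowField (-S.closedLoop p) S.X :=
  S.submanifold.isFlowField (contDiffOn_closedLoop hp).neg
    fun _ hx => (S.isChartTangent_closedLoop p hx).neg

theorem closedLoop_eq_f (hp : S.IsPassivityBasedFeedback p) (hx : x ∈ S.X) (hh : S.h x = 0) :
    S.closedLoop p x = S.f x := by
  simp [closedLoop, (hp.2 x hx).2.1 hh]

theorem f_solution_of_closedLoop (hp : S.IsPassivityBasedFeedback p)
    (hc : IsSolutionOn (S.closedLoop p) S.X c J) (hh : ∀ t ∈ J, S.h (c t) = 0) :
    IsSolutionOn S.f S.X c J :=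
  hc.congr_field fun t ht => closedLoop_eq_f hp (hc.1 ht) (hh t ht)

theorem closedLoop_solution_of_f (hp : S.IsPassivityBasedFeedback p)
    (hc : IsSolutionOn S.f S.X c J) (hh : ∀ t ∈ J, S.h (c t) = 0) :
    IsSolutionOn (S.closedLoop p) S.X c J :=
  hc.congr_field fun t ht => (closedLoop_eq_f hp (hc.1 ht) (hh t ht)).symm

theorem inner_nonneg (hp : S.IsPassivityBasedFeedback p) (hx : x ∈ S.X) :
    0 ≤ inner ℝ (p x) (S.h x) := by
  by_cases hh : S.h x = 0
  · simp [hh]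
  · rw [real_inner_comm]; exact ((hp.2 x hx).2.2 hh).le

theorem continuousOn_inner (hp : S.IsPassivityBasedFeedback p)
    (hc : IsSolutionOn (S.closedLoop p) S.X c J) :
    ContinuousOn (fun t => (inner ℝ (p (c t)) (S.h (c t)) : ℝ)) J :=
  (hp.1.continuousOn.comp hc.continuousOn hc.1).inner
    (S.smooth_h.continuousOn.comp hc.continuousOn hc.1)

/-- The passivity inequality for the control generated by the feedback. -/
theorem V_add_integral_le (hV : S.IsPassiveWith V) (hp : S.IsPassivityBasedFeedback p)
    (hT : 0 ≤ T) (hc : IsSolutionOn (S.closedLoop p) S.X c (Icc 0 T)) :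
    V (c T) + ∫ t in (0 : ℝ)..T, inner ℝ (p (c t)) (S.h (c t)) ≤ V (c 0) := by
  -- the feedback control on `[0, T]`, extended by constants to a continuous function
  set u : ℝ → Vec m := IccExtend hT fun t => -p (c t) with hu
  have hpc : ContinuousOn (fun t => -p (c t)) (Icc 0 T) :=
    (hp.1.continuousOn.comp hc.continuousOn hc.1).neg
  have huc : Continuous u := (continuousOn_iff_continuous_domRestrict.1 hpc).Icc_extend'
  have hut : ∀ t ∈ Icc 0 T, u t = -p (c t) := fun t ht => IccExtend_of_mem hT _ ht
  have h := hV.2.2 u c T huc.piecewiseContinuous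
    (fun t _ => (hp.2 _ (hc.1 (projIcc 0 T hT t).2)).1) hT
    ⟨hc.1, hc.continuousOn, fun t ht _ => by
      rw [hut t (Ioo_subset_Icc_self ht)]
      exact (hc.2 t (Ioo_subset_Icc_self ht)).hasDerivAt (Icc_mem_nhds ht.1 ht.2)⟩
  have hint : ∫ t in (0 : ℝ)..T, (inner ℝ (u t) (S.h (c t)) : ℝ) =
      -∫ t in (0 : ℝ)..T, (inner ℝ (p (c t)) (S.h (c t)) : ℝ) := by
    rw [← intervalIntegral.integral_neg]
    refine intervalIntegral.integral_congr fun t ht => ?_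
    rw [uIcc_of_le hT] at ht
    simp only [hut t ht, inner_neg_left]
  rw [hint] at h
  linarith

theorem V_le (hV : S.IsPassiveWith V) (hp : S.IsPassivityBasedFeedback p)
    (hT : 0 ≤ T) (hc : IsSolutionOn (S.closedLoop p) S.X c (Icc 0 T)) : V (c T) ≤ V (c 0) := by
  have h := V_add_integral_le hV hp hT hc
  have : 0 ≤ ∫ t in (0 : ℝ)..T, (inner ℝ (p (c t)) (S.h (c t)) : ℝ) :=
    intervalIntegral.integral_nonneg hT fun t ht => inner_nonneg hp (hc.1 ht)
  linarith

/-- If the storage does not decrease along a closed-loop solution, then the output vanishes. -/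
theorem h_eq_zero_of_V_le (hV : S.IsPassiveWith V) (hp : S.IsPassivityBasedFeedback p)
    (hT : 0 < T) (hc : IsSolutionOn (S.closedLoop p) S.X c (Icc 0 T)) (h : V (c 0) ≤ V (c T)) :
    ∀ t ∈ Icc 0 T, S.h (c t) = 0 := by
  intro t ht
  by_contra hne
  have h1 := V_add_integral_le hV hp hT.le hc
  have h2 : 0 < ∫ t in (0 : ℝ)..T, (inner ℝ (p (c t)) (S.h (c t)) : ℝ) :=
    intervalIntegral.integral_pos hT (continuousOn_inner hp hc)
      (fun t ht => inner_nonneg hp (hc.1 (Ioc_subset_Icc_self ht)))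
      ⟨t, ht, by rw [real_inner_comm]; exact (hp.2 _ (hc.1 ht)).2.2 hne⟩
  linarith

theorem h_eq_zero_of_V_eq_zero (hV : S.IsPassiveWith V) (hp : S.IsPassivityBasedFeedback p)
    (hx : x ∈ S.X) (hVx : V x = 0) : S.h x = 0 := by
  obtain ⟨U, hU, r, hr, h⟩ := (isFlowField_closedLoop hp).exists_solution x hx
  obtain ⟨c, hc0, hc⟩ := h x ⟨hx, mem_of_mem_nhds hU⟩
  have := h_eq_zero_of_V_le hV hp hr hc
    (by rw [hc0, hVx]; exact hV.2.1 _ (hc.1 ⟨hr.le, le_rfl⟩)) 0 ⟨le_rfl, hr.le⟩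
  rwa [hc0] at this

theorem V_eq_zero_of_closedLoop (hV : S.IsPassiveWith V) (hp : S.IsPassivityBasedFeedback p)
    (hT : 0 ≤ T) (hc : IsSolutionOn (S.closedLoop p) S.X c (Icc 0 T)) (h0 : V (c 0) = 0) :
    V (c T) = 0 :=
  le_antisymm (h0 ▸ V_le hV hp hT hc) (hV.2.1 _ (hc.1 ⟨hT, le_rfl⟩))

/-- The zero control is admissible from a point of zero storage, so that open-loop solutions do not
leave the zero set of the storage function either. -/
theorem V_eq_zero_of_f (hV : S.IsPassiveWith V) (hp : S.IsPassivityBasedFeedback p)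
    (hT : 0 ≤ T) (hc : IsSolutionOn S.f S.X c (Icc 0 T)) (h0 : V (c 0) = 0) : V (c T) = 0 := by
  have h0X : c 0 ∈ S.X := hc.1 ⟨le_rfl, hT⟩
  have hU : (0 : Vec m) ∈ S.U := by
    have h := hp.2 _ h0X
    have := h.1
    rwa [h.2.1 (h_eq_zero_of_V_eq_zero hV hp h0X h0), neg_zero] at this
  have h := hV.2.2 (fun _ => 0) c T continuous_const.piecewiseContinuous (fun _ _ => hU) hT
    ⟨hc.1, hc.continuousOn, fun t ht _ => by
      simpa using (hc.2 t (Ioo_subset_Icc_self ht)).hasDerivAt (Icc_mem_nhds ht.1 ht.2)⟩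
  simp only [inner_zero_left, intervalIntegral.integral_zero] at h
  exact le_antisymm (by linarith) (hV.2.1 _ (hc.1 ⟨hT, le_rfl⟩))

/-- `G` is positively invariant for the closed loop, because the output vanishes on closed-loop
solutions starting in it. -/
theorem mem_of_closedLoop (hV : S.IsPassiveWith V) (hp : S.IsPassivityBasedFeedback p)
    (hG_inv : IsPositivelyInvariantSet S.f S.X G) (hG_zero : ∀ x ∈ G, V x = 0)
    (hc : IsSolutionOn (S.closedLoop p) S.X c (Icc 0 T)) (h0 : c 0 ∈ G) :
    ∀ t ∈ Icc 0 T, c t ∈ G := by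
  intro t ht
  refine hG_inv (Icc 0 T) c ordConnected_Icc ⟨le_rfl, ht.1.trans ht.2⟩
    (f_solution_of_closedLoop hp hc fun s hs => ?_) h0 t ht ht.1
  exact h_eq_zero_of_V_eq_zero hV hp (hc.1 hs) (V_eq_zero_of_closedLoop hV hp hs.1
    (hc.mono (Icc_subset_Icc_right hs.2)) (hG_zero _ h0))

/-! ### The maximal invariant subset of the zero set of the output -/

theorem h_eq_zero_of_mem_maxInvariant (hx : x ∈ S.maxInvariant) : S.h x = 0 := by
  obtain ⟨A, hA, hxA⟩ := hx
  exact (hA.1 hxA).2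

theorem isInvariantSet_maxInvariant (S : ControlSystem n m) :
    IsInvariantSet S.f S.X S.maxInvariant := by
  rintro J c hJ h0 hc ⟨A, hA, h0A⟩ t ht
  exact ⟨A, hA, hA.2 J c hJ h0 hc h0A t ht⟩

/-- Closed-loop solutions starting in the maximal invariant set are open-loop solutions. -/
theorem f_solution_of_mem_maxInvariant (hp : S.IsPassivityBasedFeedback p)
    (hc : IsSolutionOn (S.closedLoop p) S.X c (Ici 0)) (h0 : c 0 ∈ S.maxInvariant) :
    IsSolutionOn S.f S.X c (Ici 0) := by
  refine f_solution_of_closedLoop hp hc fun T hT => ?_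
  have hT : (0 : ℝ) ≤ T := hT
  have hsub : Icc 0 T ⊆ Ici (0 : ℝ) := fun t ht => ht.1
  have hcT := hc.mono hsub
  have hclosed : IsClosed ({t | S.h (c t) = 0} ∩ Icc 0 T) := by
    rw [inter_comm]
    exact (S.smooth_h.continuousOn.comp hcT.continuousOn hcT.1).preimage_isClosed_of_isClosed
      isClosed_Icc isClosed_singleton
  refine hclosed.Icc_subset_of_forall_mem_nhdsGT_of_Icc_subset (h_eq_zero_of_mem_maxInvariant h0)
    (fun t ht htO => ?_) ⟨hT, le_rfl⟩
  have hct : c t ∈ S.maxInvariant := S.isInvariantSet_maxInvariant (Icc 0 t) c ordConnected_Icc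
    ⟨le_rfl, ht.1⟩ (f_solution_of_closedLoop hp (hc.mono fun s hs => hs.1) htO) h0 t ⟨ht.1, le_rfl⟩
  -- the open-loop solution from `c t` stays in the invariant set, so it is the closed-loop one
  obtain ⟨U, hU, r, hr, h⟩ := S.isFlowField_f.exists_solution (c t) (hc.1 ht.1)
  obtain ⟨d, hd0, hd⟩ := h (c t) ⟨hc.1 ht.1, mem_of_mem_nhds hU⟩
  have hdO : ∀ s ∈ Icc 0 r, d s ∈ S.maxInvariant := S.isInvariantSet_maxInvariant (Icc 0 r) d
    ordConnected_Icc ⟨le_rfl, hr.le⟩ hd (hd0 ▸ hct)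
  have heq := (closedLoop_solution_of_f hp hd fun s hs =>
      h_eq_zero_of_mem_maxInvariant (hdO s hs)).eqOn_Icc
    (isFlowField_closedLoop hp).locallyLipschitzOn
    (hc.shift t (J' := Icc 0 r) fun s hs => add_nonneg hs.1 ht.1) (by simp [hd0])
  filter_upwards [Ioc_mem_nhdsGT (show t < t + r by linarith)] with s hs
  have hs' : s - t ∈ Icc 0 r := ⟨by linarith [hs.1], by linarith [hs.2]⟩
  have := h_eq_zero_of_mem_maxInvariant (hdO _ hs')
  rw [heq hs'] at this
  simpa using this

/-- A complete closed-loop solution with vanishing output lies in the maximal invariant set. -/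
theorem mem_maxInvariant_of_complete (hp : S.IsPassivityBasedFeedback p)
    (hc : IsSolutionOn (S.closedLoop p) S.X c univ) (hh : ∀ t, S.h (c t) = 0) (t : ℝ) :
    c t ∈ S.maxInvariant := by
  refine ⟨range c, ⟨?_, ?_⟩, mem_range_self t⟩
  · rintro _ ⟨s, rfl⟩
    exact ⟨hc.1 (mem_univ s), hh s⟩
  · rintro J d hJ h0 hd ⟨s, hs⟩ r hr
    have hf := f_solution_of_closedLoop hp hc fun t _ => hh t
    have := hd.eqOn S.isFlowField_f.locallyLipschitzOn hJ h0
      (hf.shift s (J' := J) fun _ _ => mem_univ _) (by simp [hs]) hr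
    exact ⟨r + s, this.symm⟩

/-- A closed-loop solution on `(-∞, 0]` with vanishing storage lies in the maximal invariant set:
forward in time, the storage remains zero by passivity. -/
theorem mem_maxInvariant_of_backward (hV : S.IsPassiveWith V) (hp : S.IsPassivityBasedFeedback p)
    (hc : IsSolutionOn (S.closedLoop p) S.X c (Iic 0)) (hVc : ∀ t ≤ 0, V (c t) = 0) :
    c 0 ∈ S.maxInvariant := by
  refine ⟨{x | ∃ d, d 0 = x ∧ IsSolutionOn (S.closedLoop p) S.X d (Iic 0) ∧
    ∀ t ≤ 0, V (d t) = 0}, ⟨?_, ?_⟩, c, rfl, hc, hVc⟩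
  · rintro _ ⟨d, rfl, hd, hVd⟩
    have h0 : d 0 ∈ S.X := hd.1 (mem_Iic.2 le_rfl)
    exact ⟨h0, h_eq_zero_of_V_eq_zero hV hp h0 (hVd 0 le_rfl)⟩
  · rintro J e hJ h0 he ⟨d, hd0, hd, hVd⟩ t ht
    rcases le_total t 0 with h | h
    · have hdf : IsSolutionOn S.f S.X d (Iic 0) := f_solution_of_closedLoop hp hd fun s hs =>
        h_eq_zero_of_V_eq_zero hV hp (hd.1 hs) (hVd s hs)
      have heq := (he.mono inter_subset_left).eqOn S.isFlowField_f.locallyLipschitzOn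
        (hJ.inter (t := Iic 0) ordConnected_Iic) ⟨h0, mem_Iic.2 le_rfl⟩
        (hdf.mono inter_subset_right) hd0.symm ⟨ht, h⟩
      refine ⟨fun s => d (s + t), by simp [heq], hd.shift t fun s hs => ?_, fun s hs => ?_⟩
      · have hs : s ≤ 0 := hs
        exact mem_Iic.2 (by linarith)
      · exact hVd _ (by linarith)
    · have he' : IsSolutionOn S.f S.X e (Icc 0 t) := he.mono (hJ.out h0 ht)
      have hVe : ∀ s ∈ Icc 0 t, V (e s) = 0 := fun s hs => V_eq_zero_of_f hV hp hs.1
        (he'.mono (Icc_subset_Icc_right hs.2)) (hd0 ▸ hVd 0 le_rfl)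
      have hec := closedLoop_solution_of_f hp he' fun s hs =>
        h_eq_zero_of_V_eq_zero hV hp (he'.1 hs) (hVe s hs)
      have hglue := hd.glue hec le_rfl (fun s hs => hs.1) (mem_Iic.2 le_rfl) ⟨le_rfl, h⟩ hd0
      rw [Iic_union_Icc_eq_Iic h] at hglue
      refine ⟨_, ?_, hglue.shift t (J' := Iic 0) fun s hs => ?_, fun s hs => ?_⟩
      · simp only [zero_add]
        split_ifs with h'
        · obtain rfl := le_antisymm h' h
          exact hd0
        · rfl
      · have hs : s ≤ 0 := hs
        exact mem_Iic.2 (by linarith)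
      · split_ifs with h'
        · exact hVd _ h'
        · exact hVe _ ⟨(not_le.1 h').le, by linarith⟩

/-! ### Limit points of closed-loop trajectories -/

variable {K : Set (Vec n)}

/-- LaSalle's invariance principle: the limit points of a closed-loop trajectory in a compact set
lie in the maximal invariant set, and the trajectories from them consist of limit points. -/
theorem exists_trajectory_of_limit_point (hV : S.IsPassiveWith V)
    (hp : S.IsPassivityBasedFeedback p) (hK : IsCompact K) (hKX : K ⊆ S.X)
    (hc : IsSolutionOn (S.closedLoop p) K c (Ici 0)) {s : ℕ → ℝ} (hs0 : ∀ k, 0 ≤ s k)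
    (hs : Tendsto s atTop atTop) (hx : Tendsto (fun k => c (s k)) atTop (𝓝 x)) :
    x ∈ S.maxInvariant ∧ ∃ z, z 0 = x ∧ IsSolutionOn (S.closedLoop p) K z (Ici 0) ∧
      ∀ t : ℝ, 0 ≤ t → Tendsto (fun k => c (t + s k)) atTop (𝓝 (z t)) := by
  obtain ⟨z, hz0, hz, hcz⟩ := (isFlowField_closedLoop hp).exists_limit_trajectory hK hKX
    (z := fun k t => c (t + s k)) tendsto_natCast_atTop_atTop
    (fun k => hc.shift (s k) fun t ht => add_nonneg ht.1 (hs0 k)) (by simpa using hx)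
  obtain ⟨w, hw0, hw, hcw⟩ := (isFlowField_neg_closedLoop hp).exists_limit_trajectory hK hKX
    (z := fun k t => c (s k - t)) hs
    (fun k => hc.reverse (s k) fun t ht => sub_nonneg.2 ht.2) (by simpa using hx)
  refine ⟨?_, z, hz0, hz, hcz⟩
  have hw' : IsSolutionOn (S.closedLoop p) K (fun t => w (0 - t)) (Iic 0) := by
    have := hw.reverse 0 (J' := Iic 0) fun t ht =>
      mem_Ici.2 (sub_nonneg.2 (mem_Iic.1 ht))
    rwa [neg_neg] at this
  have hglue := (hw'.glue hz le_rfl le_rfl (mem_Iic.2 le_rfl) (mem_Ici.2 le_rfl)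
    (by simp [hw0, hz0])).mono_space hKX
  rw [Iic_union_Ici] at hglue
  set e : ℝ → Vec n := fun t => if t ≤ 0 then w (0 - t) else z t with he
  have hce : ∀ t, Tendsto (fun k => c (t + s k)) atTop (𝓝 (e t)) := by
    intro t
    by_cases h : t ≤ 0
    · simp only [he, if_pos h]
      convert hcw (0 - t) (by linarith) using 3
      ring
    · simp only [he, if_neg h]
      exact hcz t (not_le.1 h).le
  -- the storage is constant on limit points
  have hanti : AntitoneOn (fun t => V (c t)) (Ici 0) := by
    intro a ha b hb hab
    have := V_le hV hp (sub_nonneg.2 hab)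
      ((hc.mono_space hKX).shift a (J' := Icc 0 (b - a)) fun t ht => add_nonneg ht.1 ha)
    simpa using this
  obtain ⟨v, hv⟩ : ∃ v, Tendsto (fun t => V (c (max t 0))) atTop (𝓝 v) := by
    refine ⟨_, tendsto_atTop_ciInf (fun a b hab => hanti (le_max_right a 0) (le_max_right b 0)
      (max_le_max_right 0 hab)) ⟨0, ?_⟩⟩
    rintro _ ⟨t, rfl⟩
    exact hV.2.1 _ (hKX (hc.1 (le_max_right t 0)))
  have hVe : ∀ t, V (e t) = v := by
    intro t
    have hts : Tendsto (fun k => t + s k) atTop atTop := tendsto_atTop_add_const_left _ t hs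
    have h1 : Tendsto (fun k => V (c (t + s k))) atTop (𝓝 v) := by
      refine (hv.comp hts).congr' ?_
      filter_upwards [hts.eventually_ge_atTop 0] with k hk
      simp [max_eq_left hk]
    refine tendsto_nhds_unique ?_ h1
    refine (hV.1.continuousOn (e t) (hglue.1 (mem_univ t))).tendsto.comp
      (tendsto_nhdsWithin_iff.2 ⟨hce t, ?_⟩)
    filter_upwards [hts.eventually_ge_atTop 0] with k hk
    exact hKX (hc.1 hk)
  have hx0 : e 0 = x := by simp [he, hw0]
  rw [← hx0]
  refine mem_maxInvariant_of_complete hp hglue (fun t => ?_) 0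
  have := h_eq_zero_of_V_le hV hp one_pos (hglue.shift t (J' := Icc 0 1) fun _ _ => mem_univ _)
    (by simp only [hVe, le_refl]) 0 ⟨le_rfl, zero_le_one⟩
  simpa using this

/-- The closed-loop trajectory from a point of the maximal invariant set is the open-loop one. -/
theorem tendsto_infDist_of_mem_maxInvariant (hp : S.IsPassivityBasedFeedback p)
    (hc : IsSolutionOn (S.closedLoop p) S.X c (Ici 0)) (h0 : c 0 ∈ S.maxInvariant)
    (hconv : ConvergesTo S.f S.X G (c 0)) :
    Tendsto (fun t => Metric.infDist (c t) G) atTop (𝓝 0) := by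
  obtain ⟨d, ⟨hd0, hd⟩, hdG⟩ := hconv
  have heq := hd.eqOn S.isFlowField_f.locallyLipschitzOn ordConnected_Ici (mem_Ici.2 le_rfl)
    (f_solution_of_mem_maxInvariant hp hc h0) hd0
  refine hdG.congr' ?_
  filter_upwards [eventually_ge_atTop 0] with t ht
  rw [heq ht]

theorem mem_of_infDist_eq_zero {X : Set (Vec n)} (hG : G.Nonempty)
    (hG_closed : ∃ C : Set (Vec n), IsClosed C ∧ G = X ∩ C) (hx : x ∈ X)
    (h : Metric.infDist x G = 0) : x ∈ G := by
  obtain ⟨C, hC, rfl⟩ := hG_closed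
  have hxc := (Metric.mem_closure_iff_infDist_zero hG).2 h
  exact ⟨hx, hC.closure_subset_iff.2 inter_subset_right hxc⟩

/-- Within a compact set, a neighbourhood of `G` contains a tube around `G`. -/
theorem exists_tube_subset {X : Set (Vec n)} (hG : G.Nonempty)
    (hG_closed : ∃ C : Set (Vec n), IsClosed C ∧ G = X ∩ C) (hK : IsCompact K) (hKX : K ⊆ X)
    {N : Set (Vec n)} (hN : IsOpen N) (hGN : G ⊆ N) :
    ∃ ε : ℝ, 0 < ε ∧ ∀ y ∈ K, Metric.infDist y G ≤ ε → y ∈ N := by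
  rcases (K \ N).eq_empty_or_nonempty with he | hne
  · exact ⟨1, one_pos, fun y hy _ => by_contra fun h =>
      (he ▸ (⟨hy, h⟩ : y ∈ K \ N) : y ∈ (∅ : Set _))⟩
  · obtain ⟨y, hy, hmin⟩ := (hK.diff hN).exists_isMinOn hne
      (Metric.continuous_infDist_pt G).continuousOn
    have hpos : 0 < Metric.infDist y G := Metric.infDist_nonneg.lt_of_ne fun h =>
      hy.2 (hGN (mem_of_infDist_eq_zero hG hG_closed (hKX hy.1) h.symm))
    refine ⟨Metric.infDist y G / 2, by linarith, fun z hz hzG => by_contra fun h => ?_⟩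
    have : Metric.infDist y G ≤ Metric.infDist z G := hmin ⟨hz, h⟩
    linarith

/-- If the points of `K ∩ O` are attracted by `G` in open loop, where `O` is the maximal invariant set,
then closed-loop trajectories in `K` come close to `G`: their limit points are in `K ∩ O`. -/
theorem exists_mem_of_forall_convergesTo (hV : S.IsPassiveWith V)
    (hp : S.IsPassivityBasedFeedback p) (hG : G.Nonempty)
    (hG_closed : ∃ C : Set (Vec n), IsClosed C ∧ G = S.X ∩ C) (hK : IsCompact K) (hKX : K ⊆ S.X)
    (hc : IsSolutionOn (S.closedLoop p) K c (Ici 0))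
    (hconv : ∀ x ∈ K ∩ S.maxInvariant, ConvergesTo S.f S.X G x) {N : Set (Vec n)} (hN : IsOpen N)
    (hGN : G ⊆ N) : ∃ t : ℝ, 0 ≤ t ∧ c t ∈ N := by
  obtain ⟨x, hxK, φ, hφ, hx⟩ := hK.tendsto_subseq fun k : ℕ => hc.1 (mem_Ici.2 k.cast_nonneg)
  obtain ⟨hxO, z, rfl, hz, hcz⟩ := exists_trajectory_of_limit_point hV hp hK hKX hc
    (s := fun k => (φ k : ℝ)) (fun k => Nat.cast_nonneg _)
    (tendsto_natCast_atTop_atTop.comp hφ.tendsto_atTop) hx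
  have hzG := tendsto_infDist_of_mem_maxInvariant hp (hz.mono_space hKX) hxO (hconv _ ⟨hxK, hxO⟩)
  obtain ⟨ε, hε, hεN⟩ := exists_tube_subset hG hG_closed hK hKX hN hGN
  obtain ⟨t, htε, ht⟩ := ((hzG.eventually (ge_mem_nhds hε)).and (eventually_ge_atTop 0)).exists
  obtain ⟨k, hk⟩ := ((hcz t ht).eventually (hN.mem_nhds (hεN _ (hz.1 ht) htε))).exists
  exact ⟨_, add_nonneg ht (Nat.cast_nonneg _), hk⟩

/-- A closed-loop trajectory which comes close to a stable set stays close to it. -/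
theorem convergesTo_of_stable (hV : S.IsPassiveWith V)
    (hp : S.IsPassivityBasedFeedback p) (hG : G.Nonempty)
    (hG_closed : ∃ C : Set (Vec n), IsClosed C ∧ G = S.X ∩ C) (hK : IsCompact K) (hKX : K ⊆ S.X)
    (hc : IsSolutionOn (S.closedLoop p) K c (Ici 0))
    (hconv : ∀ x ∈ K ∩ S.maxInvariant, ConvergesTo S.f S.X G x)
    (hstable : StableRel (S.closedLoop p) S.X univ G) :
    ConvergesTo (S.closedLoop p) S.X G (c 0) := by
  have hcX := hc.mono_space hKX
  refine ⟨c, ⟨rfl, hcX⟩, ?_⟩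
  rw [Metric.tendsto_atTop]
  intro ε hε
  obtain ⟨N, hN, hGN, h⟩ := hstable ε hε
  obtain ⟨t, ht, htN⟩ := exists_mem_of_forall_convergesTo hV hp hG hG_closed hK hKX hc hconv hN hGN
  obtain ⟨d, ⟨hd0, hd⟩, hdε⟩ := h (c t) ⟨⟨hcX.1 ht, htN⟩, mem_univ _⟩
  have heq := hd.eqOn (isFlowField_closedLoop hp).locallyLipschitzOn ordConnected_Ici
    (mem_Ici.2 le_rfl) (hcX.shift t fun s hs => add_nonneg hs ht) (by simp [hd0])
  refine ⟨t, fun s hs => ?_⟩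
  have := hdε (s - t) (by linarith)
  rw [heq (mem_Ici.2 (sub_nonneg.2 hs))] at this
  simp only [sub_add_cancel] at this
  rwa [Real.dist_eq, sub_zero, abs_of_nonneg Metric.infDist_nonneg]

end ControlSystem

/-! ### Stability of `G` for the closed loop -/

/-- If solutions starting in `G` remain in `G`, then solutions in a compact set which start closer
and closer to a point of `G` need longer and longer to reach distance `ε` from `G`. -/
theorem IsFlowField.tendsto_exit_time {n : ℕ} {F : Vec n → Vec n} {X K G : Set (Vec n)}
    (hF : IsFlowField F X) (hK : IsCompact K) (hKX : K ⊆ X)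
    (hG_inv : ∀ (T : ℝ) (c : ℝ → Vec n), IsSolutionOn F X c (Icc 0 T) → c 0 ∈ G →
      ∀ t ∈ Icc 0 T, c t ∈ G)
    {z : ℕ → ℝ → Vec n} {T : ℕ → ℝ} (hT : ∀ k, 0 ≤ T k)
    (hz : ∀ k, IsSolutionOn F K (z k) (Icc 0 (T k))) {x : Vec n} (hxG : x ∈ G)
    (hx : Tendsto (fun k => z k 0) atTop (𝓝 x)) {ε : ℝ} (hε : 0 < ε)
    (hzε : ∀ k, ε ≤ Metric.infDist (z k (T k)) G) : Tendsto T atTop atTop := by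
  obtain ⟨r, hr, hloc⟩ := hF.exists_uniform_time hK hKX
  have key : ∀ j : ℕ, ∃ w ∈ G, Tendsto (fun k => z k (j * r)) atTop (𝓝 w) ∧
      ∀ᶠ k in atTop, j * r ≤ T k := by
    intro j
    induction j with
    | zero => exact ⟨x, hxG, by simpa using hx, Eventually.of_forall fun k => by simpa using hT k⟩
    | succ j ih =>
      obtain ⟨w, hwG, hw, hjT⟩ := ih
      have hjr : 0 ≤ (j : ℝ) * r := by positivity
      have hwK : w ∈ K := hK.isClosed.mem_of_tendsto hw <| by
        filter_upwards [hjT] with k hk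
        exact (hz k).1 ⟨hjr, hk⟩
      obtain ⟨c, rfl, hc⟩ := hloc w hwK
      have hcG := hG_inv r c hc hwG
      obtain ⟨L, hL0, hL⟩ := exists_dist_solution_le hF.locallyLipschitzOn
        (hK.union hc.isCompact_image) (union_subset hKX hc.1.image_subset)
      have hest : ∀ k, ∀ s ∈ Icc 0 r, s + j * r ≤ T k →
          dist (z k (s + j * r)) (c s) ≤ dist (z k (j * r)) (c 0) * Real.exp (L * r) := by
        intro k s hs hsT
        have h := hL s (fun t => z k (t + j * r)) c
          (((hz k).shift (j * r) fun t ht =>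
            ⟨add_nonneg ht.1 hjr, by linarith [ht.2]⟩).mono_space subset_union_left)
          ((hc.image.mono (Icc_subset_Icc_right hs.2)).mono_space subset_union_right)
          s ⟨hs.1, le_rfl⟩
        simp only [zero_add] at h
        refine h.trans ?_
        gcongr
        exact hs.2
      have hlim : Tendsto (fun k => dist (z k (j * r)) (c 0) * Real.exp (L * r)) atTop (𝓝 0) := by
        simpa using (tendsto_iff_dist_tendsto_zero.1 hw).mul_const (Real.exp (L * r))
      have hjT' : ∀ᶠ k in atTop, r + j * r ≤ T k := by
        filter_upwards [hjT, hlim.eventually (gt_mem_nhds hε)] with k hk hkε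
        by_contra! hlt
        have hs : T k - j * r ∈ Icc 0 r := ⟨by linarith, by linarith⟩
        have h1 := hest k _ hs (by linarith)
        rw [sub_add_cancel] at h1
        have h2 := Metric.infDist_le_dist_of_mem (x := z k (T k)) (hcG _ hs)
        linarith [hzε k]
      have hsucc : ((j + 1 : ℕ) : ℝ) * r = r + j * r := by push_cast; ring
      refine ⟨c r, hcG r ⟨hr.le, le_rfl⟩, ?_, by rwa [hsucc]⟩
      rw [hsucc, tendsto_iff_dist_tendsto_zero]
      refine squeeze_zero' (Eventually.of_forall fun _ => dist_nonneg) ?_ hlim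
      filter_upwards [hjT'] with k hk
      exact hest k r ⟨hr.le, le_rfl⟩ hk
  rw [tendsto_atTop]
  intro b
  obtain ⟨j, hj⟩ := exists_nat_ge (b / r)
  obtain ⟨-, -, -, h⟩ := key j
  filter_upwards [h] with k hk
  exact ((div_le_iff₀ hr).1 hj).trans hk

/-- Near each point of `G`, solutions of `ẋ = F x` in `X` cannot leave some compact subset of `X`
before they leave a tube around `G`. -/
def IsLocallyTrapped {n : ℕ} (F : Vec n → Vec n) (X G : Set (Vec n)) : Prop :=
  ∀ x ∈ G, ∃ K : Set (Vec n), IsCompact K ∧ K ⊆ X ∧ ∃ l : ℝ, 0 < l ∧ ∃ r : ℝ, 0 < r ∧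
    ∀ (c : ℝ → Vec n) (T : ℝ), 0 ≤ T → IsSolutionOn F X c (Icc 0 T) → c 0 ∈ Metric.ball x l →
      (∀ t ∈ Icc 0 T, Metric.infDist (c t) G ≤ r) → c T ∈ K

theorem IsSmoothSubmanifold.isLocallyTrapped {n : ℕ} {F : Vec n → Vec n} {X G : Set (Vec n)}
    (hX : IsSmoothSubmanifold X) (hG : G.Nonempty) (hGc : IsCompact G) (hGX : G ⊆ X) :
    IsLocallyTrapped F X G := by
  intro x _
  obtain ⟨K, U, hK, hKX, hU, hGU, hUK⟩ := hX.exists_compact_nhds hGc hGX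
  obtain ⟨δ, hδ, hδU⟩ := hGc.exists_thickening_subset_open hU hGU
  refine ⟨K, hK, hKX, 1, one_pos, δ / 2, by linarith, fun c T hT hc _ h => ?_⟩
  refine hUK ⟨hc.1 ⟨hT, le_rfl⟩, hδU ?_⟩
  rw [Metric.mem_thickening_iff_infDist_lt hG]
  linarith [h T ⟨hT, le_rfl⟩]

theorem LocallyUniformlyBoundedNear.isLocallyTrapped {n : ℕ} {F : Vec n → Vec n}
    {X G : Set (Vec n)} (hF : LocallyLipschitzOn X F) (h : LocallyUniformlyBoundedNear F X G) :
    IsLocallyTrapped F X G := by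
  intro x hx
  obtain ⟨l, r, hl, -, hex, hball, hclos⟩ := h x hx
  refine ⟨_, (Metric.isBounded_ball.subset hball).isCompact_closure, hclos, l, hl, 1, one_pos,
    fun c T hT hc h0 _ => subset_closure ?_⟩
  have h0' : c 0 ∈ X ∩ Metric.ball x l := ⟨hc.1 ⟨le_rfl, hT⟩, h0⟩
  obtain ⟨d, hd⟩ := hex _ h0'
  have heq := (hd.2.mono fun t ht => ht.1).eqOn_Icc hF hc hd.1
  exact ⟨c 0, h0', d, hd, T, hT, heq ⟨hT, le_rfl⟩⟩

/-- A solution from a point of the tube of radius `ε` around `G` either remains in this tube and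
in `K` forever, or remains there up to a time when its distance from `G` is `ε`. -/
theorem IsFlowField.trajectory_or_exit {n : ℕ} {F : Vec n → Vec n} {X K G : Set (Vec n)}
    (hF : IsFlowField F X) (hK : IsCompact K) (hKX : K ⊆ X) {x₀ : Vec n} (hx₀ : x₀ ∈ X)
    {ε : ℝ} (hε : Metric.infDist x₀ G ≤ ε)
    (hstay : ∀ (c : ℝ → Vec n) (T : ℝ), 0 ≤ T → IsSolutionOn F X c (Icc 0 T) → c 0 = x₀ →
      (∀ t ∈ Icc 0 T, Metric.infDist (c t) G ≤ ε) → c T ∈ K) :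
    (∃ c, c 0 = x₀ ∧ IsSolutionOn F (K ∩ {y | Metric.infDist y G ≤ ε}) c (Ici 0)) ∨
      ∃ T : ℝ, 0 ≤ T ∧ ∃ c, c 0 = x₀ ∧
        IsSolutionOn F (K ∩ {y | Metric.infDist y G ≤ ε}) c (Icc 0 T) ∧
        Metric.infDist (c T) G = ε := by
  have hclosed : IsClosed {y : Vec n | Metric.infDist y G ≤ ε} :=
    isClosed_le (Metric.continuous_infDist_pt G) continuous_const
  rcases hF.escape_or_trajectory (hK.inter_right hclosed) (inter_subset_left.trans hKX) hx₀ with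
    ⟨T, hT, c, rfl, hc, hcT⟩ | h
  swap
  · exact Or.inl h
  right
  have hg : ContinuousOn (fun t => Metric.infDist (c t) G) (Icc 0 T) :=
    (Metric.continuous_infDist_pt G).comp_continuousOn hc.continuousOn
  -- by the intermediate value theorem, the distance `ε` is attained before it is exceeded
  have hivt : ∀ t ∈ Icc 0 T, ε < Metric.infDist (c t) G →
      ∃ s ∈ Ico 0 t, Metric.infDist (c s) G = ε := by
    intro t ht hlt
    obtain ⟨s, hs, hsε⟩ := intermediate_value_Icc ht.1 (hg.mono (Icc_subset_Icc_right ht.2))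
      ⟨hε, hlt.le⟩
    refine ⟨s, ⟨hs.1, hs.2.lt_of_ne ?_⟩, hsε⟩
    rintro rfl
    exact hlt.ne' hsε
  obtain ⟨t, ht, htε⟩ : ∃ t ∈ Icc 0 T, ε < Metric.infDist (c t) G := by
    by_contra! hall
    exact hcT ⟨hstay c T hT hc rfl hall, hall T ⟨hT, le_rfl⟩⟩
  obtain ⟨s, hs, hsε⟩ := hivt t ht htε
  have hcomp : IsCompact (Icc 0 T ∩ (fun t => Metric.infDist (c t) G) ⁻¹' {ε}) :=
    isCompact_Icc.of_isClosed_subset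
      (hg.preimage_isClosed_of_isClosed isClosed_Icc isClosed_singleton) inter_subset_left
  obtain ⟨τ, ⟨hτ, hτε⟩, hmin⟩ :=
    hcomp.exists_isLeast ⟨s, ⟨hs.1, hs.2.le.trans ht.2⟩, hsε⟩
  have hle : ∀ t ∈ Icc 0 τ, Metric.infDist (c t) G ≤ ε := by
    intro t ht
    by_contra! hlt
    obtain ⟨s, hs, hsε⟩ := hivt t ⟨ht.1, ht.2.trans hτ.2⟩ hlt
    have : τ ≤ s := hmin ⟨⟨hs.1, hs.2.le.trans (ht.2.trans hτ.2)⟩, hsε⟩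
    linarith [hs.2, ht.2]
  have hcτ := hc.mono (Icc_subset_Icc_right hτ.2)
  exact ⟨τ, hτ.1, c, rfl, ⟨fun t ht => ⟨hstay c t ht.1 (hcτ.mono (Icc_subset_Icc_right ht.2)) rfl
    fun s hs => hle s ⟨hs.1, hs.2.trans ht.2⟩, hle t ht⟩, hcτ.2⟩, hτε⟩

namespace ControlSystem

variable {n m : ℕ} {S : ControlSystem n m} {V : Vec n → ℝ} {p : Vec n → Vec m}
  {G K : Set (Vec n)} {c : ℝ → Vec n} {x : Vec n}

theorem mem_maxInvariant_of_neg_trajectory (hV : S.IsPassiveWith V)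
    (hp : S.IsPassivityBasedFeedback p) {z : ℝ → Vec n}
    (hz : IsSolutionOn (-S.closedLoop p) S.X z (Ici 0)) (hVz : ∀ s, 0 ≤ s → V (z s) = 0) {s : ℝ}
    (hs : 0 ≤ s) : z s ∈ S.maxInvariant := by
  have h := hz.reverse s (J' := Iic 0) fun t ht =>
    mem_Ici.2 (by linarith [mem_Iic.1 ht])
  rw [neg_neg] at h
  have := mem_maxInvariant_of_backward hV hp h fun t ht => hVz _ (by linarith)
  simpa using this

/-- A backward closed-loop trajectory with zero storage in a compact set of points attracted by `G`
starts in the closure of `G`: going far enough back in time along it, there are points close to its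
limit points, hence points which get close to `G`. As the whole trajectory lies in the maximal
invariant set, relative stability keeps it close to `G` from there on. -/
theorem infDist_lt_of_backward (hV : S.IsPassiveWith V)
    (hp : S.IsPassivityBasedFeedback p) (hG : G.Nonempty)
    (hG_closed : ∃ C : Set (Vec n), IsClosed C ∧ G = S.X ∩ C) (hK : IsCompact K) (hKX : K ⊆ S.X)
    (hstable : StableRel S.f S.X S.maxInvariant G)
    (hconv : ∀ x ∈ K ∩ S.maxInvariant, ConvergesTo S.f S.X G x) {z : ℝ → Vec n}
    (hz : IsSolutionOn (-S.closedLoop p) K z (Ici 0)) (hVz : ∀ s, 0 ≤ s → V (z s) = 0) {ε : ℝ}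
    (hε : 0 < ε) : Metric.infDist (z 0) G < ε := by
  have hzX := hz.mono_space hKX
  have hzO : ∀ s, 0 ≤ s → z s ∈ S.maxInvariant := fun s hs =>
    mem_maxInvariant_of_neg_trajectory hV hp hzX hVz hs
  -- a limit point `a` of `z`, the backward limit `v` and the forward limit `w` through it
  obtain ⟨a, haK, φ, hφ, ha⟩ := hK.tendsto_subseq fun k : ℕ => hz.1 (mem_Ici.2 k.cast_nonneg)
  have hs : Tendsto (fun k => (φ k : ℝ)) atTop atTop :=
    tendsto_natCast_atTop_atTop.comp hφ.tendsto_atTop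
  obtain ⟨v, hv0, hv, hzv⟩ := (isFlowField_neg_closedLoop hp).exists_limit_trajectory hK hKX
    (z := fun k t => z (t + φ k)) tendsto_natCast_atTop_atTop
    (fun k => hz.shift (φ k) fun t ht => add_nonneg ht.1 (Nat.cast_nonneg _))
    (by simpa [Function.comp_def] using ha)
  obtain ⟨w, hw0, hw, hzw⟩ := (isFlowField_closedLoop hp).exists_limit_trajectory hK hKX
    (z := fun k t => z (φ k - t)) hs
    (fun k => by
      have := hz.reverse (φ k) (J' := Icc 0 (φ k : ℝ)) fun t ht => mem_Ici.2 (sub_nonneg.2 ht.2)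
      rwa [neg_neg] at this) (by simpa [Function.comp_def] using ha)
  have hVv : ∀ s, 0 ≤ s → V (v s) = 0 := by
    intro s hs
    refine tendsto_nhds_unique ((hV.1.continuousOn (v s) (hKX (hv.1 hs))).tendsto.comp
      (tendsto_nhdsWithin_iff.2 ⟨hzv s hs, Eventually.of_forall fun k =>
        hzX.1 (add_nonneg hs (Nat.cast_nonneg _))⟩)) ?_
    refine tendsto_const_nhds.congr fun k => ?_
    exact (hVz _ (add_nonneg hs (Nat.cast_nonneg _))).symm
  have haO : w 0 ∈ S.maxInvariant := by
    have := mem_maxInvariant_of_neg_trajectory hV hp (hv.mono_space hKX) hVv le_rfl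
    rwa [hv0, ← hw0] at this
  have hwG := tendsto_infDist_of_mem_maxInvariant hp (hw.mono_space hKX) haO
    (hconv _ ⟨hw0 ▸ haK, haO⟩)
  obtain ⟨N, hN, hGN, hNε⟩ := hstable ε hε
  obtain ⟨η, hη, hηN⟩ := exists_tube_subset hG hG_closed hK hKX hN hGN
  obtain ⟨t, htη, ht⟩ := ((hwG.eventually (ge_mem_nhds hη)).and (eventually_ge_atTop 0)).exists
  obtain ⟨k, hkN, hkt⟩ := (((hzw t ht).eventually (hN.mem_nhds (hηN _ (hw.1 ht) htη))).and
    (hs.eventually_ge_atTop t)).exists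
  have hkt : 0 ≤ (φ k : ℝ) - t := sub_nonneg.2 hkt
  obtain ⟨d, ⟨hd0, hd⟩, hdε⟩ := hNε _ ⟨⟨hzX.1 hkt, hkN⟩, hzO _ hkt⟩
  have hrev := hzX.reverse (φ k - t) (J' := Icc 0 ((φ k : ℝ) - t))
    fun s hs => mem_Ici.2 (sub_nonneg.2 hs.2)
  rw [neg_neg] at hrev
  have heq := (hd.mono fun s hs => hs.1).eqOn_Icc S.isFlowField_f.locallyLipschitzOn
    (f_solution_of_closedLoop hp hrev fun s hs =>
      h_eq_zero_of_mem_maxInvariant (hzO _ (sub_nonneg.2 hs.2))) (by simp [hd0])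
    (show (φ k : ℝ) - t ∈ Icc 0 ((φ k : ℝ) - t) from ⟨hkt, le_rfl⟩)
  have := hdε _ hkt
  rw [heq] at this
  simpa using this

/-- Local detectability implies stability of `G` at each of its points. Otherwise solutions starting
closer and closer to the point reach a fixed distance from `G`, after longer and longer times;
reversed in time they converge to a backward trajectory with zero storage which starts at this
distance from `G`. -/
theorem exists_ball_stable (hV : S.IsPassiveWith V)
    (hp : S.IsPassivityBasedFeedback p) (hG : G.Nonempty)
    (hG_closed : ∃ C : Set (Vec n), IsClosed C ∧ G = S.X ∩ C)
    (hG_inv : IsPositivelyInvariantSet S.f S.X G) (hG_zero : ∀ x ∈ G, V x = 0)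
    (hdet : S.LocallyDetectable G) (hxG : x ∈ G) (hK : IsCompact K) (hKX : K ⊆ S.X)
    {l r : ℝ} (hl : 0 < l) (hr : 0 < r)
    (htrap : ∀ (c : ℝ → Vec n) (T : ℝ), 0 ≤ T → IsSolutionOn (S.closedLoop p) S.X c (Icc 0 T) →
      c 0 ∈ Metric.ball x l → (∀ t ∈ Icc 0 T, Metric.infDist (c t) G ≤ r) → c T ∈ K)
    {ε : ℝ} (hε : 0 < ε) :
    ∃ δ : ℝ, 0 < δ ∧ ∀ x₀ ∈ S.X ∩ Metric.ball x δ, ∃ c, c 0 = x₀ ∧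
      IsSolutionOn (S.closedLoop p) (K ∩ {y | Metric.infDist y G ≤ ε}) c (Ici 0) := by
  obtain ⟨hstable, N, hN, hGN, hconv⟩ := hdet
  obtain ⟨η, hη, hηN⟩ := exists_tube_subset hG hG_closed hK hKX hN hGN
  -- it suffices to treat small `ε`
  wlog hsmall : ε ≤ r ∧ ε ≤ η generalizing ε
  · obtain ⟨δ, hδ, h⟩ := this (lt_min hε (lt_min hr hη))
      ⟨(min_le_right _ _).trans (min_le_left _ _), (min_le_right _ _).trans (min_le_right _ _)⟩
    refine ⟨δ, hδ, fun x₀ hx₀ => ?_⟩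
    obtain ⟨c, hc0, hc⟩ := h x₀ hx₀
    exact ⟨c, hc0, hc.mono_space fun y hy =>
      ⟨hy.1, le_trans (show Metric.infDist y G ≤ _ from hy.2) (min_le_left _ _)⟩⟩
  have hclosed : IsClosed {y : Vec n | Metric.infDist y G ≤ ε} :=
    isClosed_le (Metric.continuous_infDist_pt G) continuous_const
  set K₀ : Set (Vec n) := K ∩ {y | Metric.infDist y G ≤ ε} with hK₀
  have hK₀c : IsCompact K₀ := hK.inter_right hclosed
  have hK₀X : K₀ ⊆ S.X := inter_subset_left.trans hKX
  by_contra! hcon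
  have hseq : ∀ k : ℕ, ∃ T : ℝ, 0 ≤ T ∧ ∃ c : ℝ → Vec n, dist (c 0) x < 1 / ((k : ℝ) + 1) ∧
      IsSolutionOn (S.closedLoop p) K₀ c (Icc 0 T) ∧ Metric.infDist (c T) G = ε := by
    intro k
    obtain ⟨x₀, ⟨hx₀X, hx₀⟩, hno⟩ := hcon (min (1 / ((k : ℝ) + 1)) (min l ε))
      (lt_min (by positivity) (lt_min hl hε))
    rw [Metric.mem_ball, lt_min_iff, lt_min_iff] at hx₀
    rcases (isFlowField_closedLoop hp).trajectory_or_exit hK hKX hx₀X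
      ((Metric.infDist_le_dist_of_mem hxG).trans hx₀.2.2.le)
      (fun c T hT hc hc0 h => htrap c T hT hc (by rw [hc0]; exact hx₀.2.1)
        fun t ht => (h t ht).trans hsmall.1) with ⟨c, hc0, hc⟩ | ⟨T, hT, c, hc0, hc, hcT⟩
    · exact absurd hc (hno c hc0)
    · exact ⟨T, hT, c, hc0 ▸ hx₀.1, hc, hcT⟩
  choose T hT z hz0 hz hzT using hseq
  have hx : Tendsto (fun k => z k 0) atTop (𝓝 x) := by
    rw [tendsto_iff_dist_tendsto_zero]
    exact squeeze_zero (fun _ => dist_nonneg) (fun k => (hz0 k).le)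
      tendsto_one_div_add_atTop_nhds_zero_nat
  have hTtop : Tendsto T atTop atTop := (isFlowField_closedLoop hp).tendsto_exit_time hK₀c hK₀X
    (fun _ _ hc h0 => mem_of_closedLoop hV hp hG_inv hG_zero hc h0) hT hz hxG hx hε
    fun k => (hzT k).ge
  obtain ⟨y, -, φ, hφ, hy⟩ := hK₀c.tendsto_subseq fun k => (hz k).1 ⟨hT k, le_rfl⟩
  obtain ⟨w, hw0, hw, hzw⟩ := (isFlowField_neg_closedLoop hp).exists_limit_trajectory hK₀c hK₀X
    (z := fun k t => z (φ k) (T (φ k) - t)) (hTtop.comp hφ.tendsto_atTop)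
    (fun k => (hz (φ k)).reverse _ fun t ht => ⟨sub_nonneg.2 ht.2, sub_le_self _ ht.1⟩)
    (by simpa [Function.comp_def] using hy)
  have hGX : x ∈ S.X := by
    obtain ⟨C, -, rfl⟩ := hG_closed
    exact hxG.1
  have hVx : Tendsto (fun k => V (z (φ k) 0)) atTop (𝓝 0) := by
    have h := (hV.1.continuousOn x hGX).tendsto.comp (tendsto_nhdsWithin_iff.2
      ⟨hx.comp hφ.tendsto_atTop, Eventually.of_forall fun k =>
        hK₀X ((hz (φ k)).1 ⟨le_rfl, hT (φ k)⟩)⟩)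
    rwa [hG_zero x hxG] at h
  have hVw : ∀ s, 0 ≤ s → V (w s) = 0 := by
    intro s hs
    have hwX := hK₀X (hw.1 hs)
    refine le_antisymm ?_ (hV.2.1 _ hwX)
    have hev : ∀ᶠ k in atTop, s ≤ T (φ k) :=
      (hTtop.comp hφ.tendsto_atTop).eventually_ge_atTop s
    have hlim : Tendsto (fun k => V (z (φ k) (T (φ k) - s))) atTop (𝓝 (V (w s))) := by
      refine (hV.1.continuousOn (w s) hwX).tendsto.comp (tendsto_nhdsWithin_iff.2 ⟨hzw s hs, ?_⟩)
      filter_upwards [hev] with k hk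
      exact hK₀X ((hz (φ k)).1 ⟨sub_nonneg.2 hk, sub_le_self _ hs⟩)
    refine le_of_tendsto_of_tendsto hlim hVx ?_
    filter_upwards [hev] with k hk
    exact V_le hV hp (sub_nonneg.2 hk)
      (((hz (φ k)).mono (Icc_subset_Icc_right (sub_le_self _ hs))).mono_space hK₀X)
  have hlt := infDist_lt_of_backward hV hp hG hG_closed hK₀c hK₀X hstable
    (fun a ha => hconv a ⟨⟨hK₀X ha.1, hηN a ha.1.1 (le_trans ha.1.2 hsmall.2)⟩, ha.2⟩) hw hVw hε
  rw [hw0] at hlt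
  have hyε : Metric.infDist y G = ε := by
    refine tendsto_nhds_unique (((Metric.continuous_infDist_pt G).tendsto y).comp hy) ?_
    exact tendsto_const_nhds.congr fun k => (hzT (φ k)).symm
  exact hlt.ne hyε

end ControlSystem

/-! ### Stability, attraction and detectability -/

theorem exists_open_superset_of_forall_ball {n : ℕ} {X G : Set (Vec n)} {P : Vec n → Prop}
    (h : ∀ x ∈ G, ∃ δ : ℝ, 0 < δ ∧ ∀ x₀ ∈ X ∩ Metric.ball x δ, P x₀) :
    ∃ N : Set (Vec n), IsOpen N ∧ G ⊆ N ∧ ∀ x₀ ∈ X ∩ N ∩ univ, P x₀ := by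
  refine ⟨⋃₀ {B | IsOpen B ∧ ∀ x₀ ∈ X ∩ B, P x₀}, isOpen_sUnion fun B hB => hB.1, ?_, ?_⟩
  · intro x hx
    obtain ⟨δ, hδ, hP⟩ := h x hx
    exact ⟨Metric.ball x δ, ⟨Metric.isOpen_ball, hP⟩, Metric.mem_ball_self hδ⟩
  · rintro x₀ ⟨⟨hX, B, hB, hxB⟩, -⟩
    exact hB.2 x₀ ⟨hX, hxB⟩

/-- A neighbourhood of a compact set contains a full tube around it, not only the part of the tube in
a compact set as in `ControlSystem.exists_tube_subset`. -/
theorem exists_tube_of_open {n : ℕ} {G N : Set (Vec n)} (hG : G.Nonempty) (hGc : IsCompact G)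
    (hN : IsOpen N) (hGN : G ⊆ N) :
    ∃ δ : ℝ, 0 < δ ∧ ∀ x, Metric.infDist x G < δ → x ∈ N := by
  obtain ⟨δ, hδ, h⟩ := hGc.exists_thickening_subset_open hN hGN
  exact ⟨δ, hδ, fun x hx => h ((Metric.mem_thickening_iff_infDist_lt hG).2 hx)⟩

theorem exists_open_of_tube {n : ℕ} (G : Set (Vec n)) {δ : ℝ} (hδ : 0 < δ) :
    ∃ N : Set (Vec n), IsOpen N ∧ G ⊆ N ∧ ∀ x ∈ N, Metric.infDist x G < δ :=
  ⟨{x | Metric.infDist x G < δ}, isOpen_lt (Metric.continuous_infDist_pt G) continuous_const,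
    fun x hx => by simpa [Metric.infDist_zero_of_mem hx] using hδ, fun _ hx => hx⟩

theorem uniformlyStable_iff_stableRel {n : ℕ} {F : Vec n → Vec n} {X G : Set (Vec n)}
    (hG : G.Nonempty) (hGc : IsCompact G) : UniformlyStable F X G ↔ StableRel F X univ G := by
  refine forall₂_congr fun ε _ => ⟨?_, ?_⟩
  · rintro ⟨δ, hδ, h⟩
    obtain ⟨N, hN, hGN, hNδ⟩ := exists_open_of_tube G hδ
    exact ⟨N, hN, hGN, fun x hx => h x hx.1.1 (hNδ x hx.1.2)⟩
  · rintro ⟨N, hN, hGN, h⟩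
    obtain ⟨δ, hδ, hδN⟩ := exists_tube_of_open hG hGc hN hGN
    exact ⟨δ, hδ, fun x hxX hx => h x ⟨⟨hxX, hδN x hx⟩, mem_univ _⟩⟩

/-- For compact `G` the tubes `B_δ(G)` are a basis of neighbourhoods, so the two notions agree. -/
theorem asymptoticallyStable_iff_semi {n : ℕ} {F : Vec n → Vec n} {X G : Set (Vec n)}
    (hG : G.Nonempty) (hGc : IsCompact G) :
    AsymptoticallyStable F X G ↔ SemiAsymptoticallyStable F X G := by
  refine and_congr (uniformlyStable_iff_stableRel hG hGc) ⟨?_, ?_⟩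
  · rintro ⟨δ, hδ, h⟩
    obtain ⟨N, hN, hGN, hNδ⟩ := exists_open_of_tube G hδ
    exact ⟨N, hN, hGN, fun x hx => h x hx.1.1 (hNδ x hx.1.2)⟩
  · rintro ⟨N, hN, hGN, h⟩
    obtain ⟨δ, hδ, hδN⟩ := exists_tube_of_open hG hGc hN hGN
    exact ⟨δ, hδ, fun x hxX hx => h x ⟨⟨hxX, hδN x hx⟩, mem_univ _⟩⟩

theorem globallyAsymptoticallyStable_iff_semi {n : ℕ} {F : Vec n → Vec n} {X G : Set (Vec n)}
    (hG : G.Nonempty) (hGc : IsCompact G) :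
    GloballyAsymptoticallyStable F X G ↔ GloballySemiAsymptoticallyStable F X G :=
  and_congr (uniformlyStable_iff_stableRel hG hGc)
    ⟨fun h x hx => h x hx.1, fun h x hx => h x ⟨hx, mem_univ _⟩⟩

namespace ControlSystem

variable {n m : ℕ} {S : ControlSystem n m} {V : Vec n → ℝ} {p : Vec n → Vec m}
  {G : Set (Vec n)} {x : Vec n}

theorem isTrajectory_f_of_mem_maxInvariant (hp : S.IsPassivityBasedFeedback p) {c : ℝ → Vec n}
    (hc : IsTrajectory (S.closedLoop p) S.X x c) (hx : x ∈ S.maxInvariant) :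
    IsTrajectory S.f S.X x c :=
  ⟨hc.1, f_solution_of_mem_maxInvariant hp hc.2 (hc.1.symm ▸ hx)⟩

theorem convergesTo_f_of_mem_maxInvariant (hp : S.IsPassivityBasedFeedback p)
    (h : ConvergesTo (S.closedLoop p) S.X G x) (hx : x ∈ S.maxInvariant) :
    ConvergesTo S.f S.X G x := by
  obtain ⟨c, hc, hcG⟩ := h
  exact ⟨c, isTrajectory_f_of_mem_maxInvariant hp hc hx, hcG⟩

theorem stableRel_maxInvariant (hp : S.IsPassivityBasedFeedback p)
    (h : StableRel (S.closedLoop p) S.X univ G) : StableRel S.f S.X S.maxInvariant G := by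
  intro ε hε
  obtain ⟨N, hN, hGN, hNε⟩ := h ε hε
  refine ⟨N, hN, hGN, fun x hx => ?_⟩
  obtain ⟨c, hc, hcε⟩ := hNε x ⟨hx.1, mem_univ _⟩
  exact ⟨c, isTrajectory_f_of_mem_maxInvariant hp hc hx.2, hcε⟩

theorem locallyDetectable_of_semiAsymptoticallyStable (hp : S.IsPassivityBasedFeedback p)
    (h : SemiAsymptoticallyStable (S.closedLoop p) S.X G) : S.LocallyDetectable G := by
  obtain ⟨hs, N, hN, hGN, hconv⟩ := h
  exact ⟨stableRel_maxInvariant hp hs, N, hN, hGN, fun x hx =>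
    convergesTo_f_of_mem_maxInvariant hp (hconv x ⟨hx.1, mem_univ _⟩) hx.2⟩

theorem detectable_of_globallySemiAsymptoticallyStable (hp : S.IsPassivityBasedFeedback p)
    (h : GloballySemiAsymptoticallyStable (S.closedLoop p) S.X G) : S.Detectable G :=
  ⟨stableRel_maxInvariant hp h.1, fun x hx =>
    convergesTo_f_of_mem_maxInvariant hp (h.2 x ⟨hx.1, mem_univ _⟩) hx.2⟩

theorem Detectable.locallyDetectable (h : S.Detectable G) : S.LocallyDetectable G :=
  ⟨h.1, univ, isOpen_univ, subset_univ _, fun x hx => h.2 x ⟨hx.1.1, hx.2⟩⟩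

theorem semiAsymptoticallyStable_of_locallyDetectable (hV : S.IsPassiveWith V)
    (hp : S.IsPassivityBasedFeedback p) (hG : G.Nonempty)
    (hG_closed : ∃ C : Set (Vec n), IsClosed C ∧ G = S.X ∩ C)
    (hG_inv : IsPositivelyInvariantSet S.f S.X G) (hG_zero : ∀ x ∈ G, V x = 0)
    (htrap : IsLocallyTrapped (S.closedLoop p) S.X G) (hdet : S.LocallyDetectable G) :
    SemiAsymptoticallyStable (S.closedLoop p) S.X G := by
  have hstable : StableRel (S.closedLoop p) S.X univ G := by
    refine fun ε hε => exists_open_superset_of_forall_ball fun x hx => ?_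
    obtain ⟨K, hK, hKX, l, hl, r, hr, h⟩ := htrap x hx
    obtain ⟨δ, hδ, hδc⟩ := exists_ball_stable hV hp hG hG_closed hG_inv hG_zero hdet hx hK hKX hl hr
      h (half_pos hε)
    refine ⟨δ, hδ, fun x₀ hx₀ => ?_⟩
    obtain ⟨c, hc0, hc⟩ := hδc x₀ hx₀
    exact ⟨c, ⟨hc0, hc.mono_space (inter_subset_left.trans hKX)⟩, fun t ht =>
      (hc.1 ht).2.trans_lt (half_lt_self hε)⟩
  refine ⟨hstable, exists_open_superset_of_forall_ball fun x hx => ?_⟩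
  obtain ⟨K, hK, hKX, l, hl, r, hr, h⟩ := htrap x hx
  obtain ⟨-, N, hN, hGN, hconv⟩ := id hdet
  obtain ⟨η, hη, hηN⟩ := exists_tube_subset hG hG_closed hK hKX hN hGN
  obtain ⟨δ, hδ, hδc⟩ := exists_ball_stable hV hp hG hG_closed hG_inv hG_zero hdet hx hK hKX hl hr
    h hη
  refine ⟨δ, hδ, fun x₀ hx₀ => ?_⟩
  obtain ⟨c, rfl, hc⟩ := hδc x₀ hx₀
  exact convergesTo_of_stable hV hp hG hG_closed
    (hK.inter_right (isClosed_le (Metric.continuous_infDist_pt G) continuous_const))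
    (inter_subset_left.trans hKX) hc
    (fun y hy => hconv y ⟨⟨hKX hy.1.1, hηN y hy.1.1 hy.1.2⟩, hy.2⟩) hstable

theorem globallySemiAsymptoticallyStable_of_detectable (hV : S.IsPassiveWith V)
    (hp : S.IsPassivityBasedFeedback p) (hG : G.Nonempty)
    (hG_closed : ∃ C : Set (Vec n), IsClosed C ∧ G = S.X ∩ C)
    (hG_inv : IsPositivelyInvariantSet S.f S.X G) (hG_zero : ∀ x ∈ G, V x = 0)
    (htrap : IsLocallyTrapped (S.closedLoop p) S.X G)
    (hbdd : AllTrajectoriesBounded (S.closedLoop p) S.X) (hdet : S.Detectable G) :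
    GloballySemiAsymptoticallyStable (S.closedLoop p) S.X G := by
  have hstable := (semiAsymptoticallyStable_of_locallyDetectable hV hp hG hG_closed hG_inv hG_zero
    htrap hdet.locallyDetectable).1
  refine ⟨hstable, fun x hx => ?_⟩
  obtain ⟨⟨c, hc⟩, hb, hcl⟩ := hbdd x hx.1
  have hcK : IsSolutionOn (S.closedLoop p)
      (closure (forwardReach (S.closedLoop p) S.X {x})) c (Ici 0) :=
    ⟨fun t ht => subset_closure ⟨x, rfl, c, hc, t, ht, rfl⟩, hc.2.2⟩
  have := convergesTo_of_stable hV hp hG hG_closed hb.isCompact_closure hcl hcK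
    (fun y hy => hdet.2 y ⟨hcl hy.1, hy.2⟩) hstable
  rwa [hc.1] at this

theorem semiAsymptoticallyStable_iff (hV : S.IsPassiveWith V)
    (hp : S.IsPassivityBasedFeedback p) (hG : G.Nonempty)
    (hG_closed : ∃ C : Set (Vec n), IsClosed C ∧ G = S.X ∩ C)
    (hG_inv : IsPositivelyInvariantSet S.f S.X G) (hG_zero : ∀ x ∈ G, V x = 0)
    (htrap : IsLocallyTrapped (S.closedLoop p) S.X G) :
    (SemiAsymptoticallyStable (S.closedLoop p) S.X G ↔ S.LocallyDetectable G) ∧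
      (AllTrajectoriesBounded (S.closedLoop p) S.X →
        (GloballySemiAsymptoticallyStable (S.closedLoop p) S.X G ↔ S.Detectable G)) :=
  ⟨⟨locallyDetectable_of_semiAsymptoticallyStable hp,
    semiAsymptoticallyStable_of_locallyDetectable hV hp hG hG_closed hG_inv hG_zero htrap⟩,
  fun hbdd => ⟨detectable_of_globallySemiAsymptoticallyStable hp,
    globallySemiAsymptoticallyStable_of_detectable hV hp hG hG_closed hG_inv hG_zero htrap hbdd⟩⟩

end ControlSystem

theorem mainTheorem1 {n m : ℕ} (S : ControlSystem n m)
    (V : Vec n → ℝ) (hV : S.IsPassiveWith V)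
    (p : Vec n → Vec m) (hp : S.IsPassivityBasedFeedback p)
    (G : Set (Vec n)) (hG_nonempty : G.Nonempty)
    (hG_closed : ∃ C : Set (Vec n), IsClosed C ∧ G = S.X ∩ C)
    (hG_inv : IsPositivelyInvariantSet S.f S.X G)
    (hG_zero : ∀ x ∈ G, V x = 0) :
    (IsCompact G →
      (AsymptoticallyStable (S.closedLoop p) S.X G ↔ S.LocallyDetectable G) ∧
      (AllTrajectoriesBounded (S.closedLoop p) S.X →
        (GloballyAsymptoticallyStable (S.closedLoop p) S.X G ↔ S.Detectable G))) ∧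
    (¬ IsCompact G → LocallyUniformlyBoundedNear (S.closedLoop p) S.X G →
      (SemiAsymptoticallyStable (S.closedLoop p) S.X G ↔ S.LocallyDetectable G) ∧
      (AllTrajectoriesBounded (S.closedLoop p) S.X →
        (GloballySemiAsymptoticallyStable (S.closedLoop p) S.X G ↔ S.Detectable G))) := by
  refine ⟨fun hGc => ?_, fun _ hlub => ?_⟩
  · have hGX : G ⊆ S.X := by
      obtain ⟨C, -, rfl⟩ := hG_closed
      exact inter_subset_left
    rw [asymptoticallyStable_iff_semi hG_nonempty hGc,
      globallyAsymptoticallyStable_iff_semi hG_nonempty hGc]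
    exact S.semiAsymptoticallyStable_iff hV hp hG_nonempty hG_closed hG_inv hG_zero
      (S.submanifold.isLocallyTrapped hG_nonempty hGc hGX)
  · exact S.semiAsymptoticallyStable_iff hV hp hG_nonempty hG_closed hG_inv hG_zero
      (hlub.isLocallyTrapped (ControlSystem.isFlowField_closedLoop hp).locallyLipschitzOn)
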